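/- **Proposition.** *Definitions.* Let $G$ be a finite abelian group with dual group $\widehat G$. A Bohr set $B$ with frequency set $\Gamma\subset\widehat G$ and width function $\delta\in(0,2]^\Gamma$ is the set $\{x\in G: |1-\gamma(x)|\le\delta_\gamma \text{ for all }\gamma\in\Gamma\}$; its rank is $|\Gamma|$, and for $\rho>0$ the dilate $B_\rho$ is the Bohr set with the same frequencies and widths $\min\{\rho\delta_\gamma,2\}$. For a non-empty finite set $X\subset G$ write $\mu_X$ for the uniform probability measure on $X$; write $\beta,\beta',\beta'',\beta'''$ for the measures $\mu_B,\mu_{B'},\mu_{B''},\mu_{B'''}$. For a function $f$ and a measure $\nu$ on $G$, $f*\nu(x)=\int f(x-y)\,d\nu(y)$, and $1_S\,d\nu$ is the restriction of $\nu$ to $S$. A Bohr set $B$ is $d$-dimensional if $|B_{2\rho}|\le 2^d|B_\rho|$ for all $\rho\in(0,1]$. It is regular as a $d$-dimensional Bohr set if it is $d$-dimensional and $$\frac1{1+C_{\mathcal R}d|\eta|}\le\frac{|B_{1+\eta}|}{|B_1|}\le 1+C_{\mathcal R}d|\eta|\quad\text{whenever } 1+\eta>0,\ |\eta|\le \frac1{C_{\mathcal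 R}d},$$ where $C_{\mathcal R}\geq 1$ is a fixed constant that is at least a certain absolute constant. It is called regular, without mention of $d$, if this holds for every $d\ge1$ for which it is $d$-dimensional. *Statement.* For every $K>0$ there are constants $c\in(0,1]$ and $C\ge1$, depending only on $K$ and $C_{\mathcal R}$, with the following property. Let $G$ be a finite abelian group, $d>0$, $k\ge1$ an integer, $0<d'\le Kk$ and $\rho',\rho''>0$. Let $B\subset G$ be a regular $d$-dimensional Bohr set, let $B'$ be a Bohr set of rank $k$ that is regular as a $d'$-dimensional Bohr set, with $B'\subset B_{\rho'}$, and let $B''$ be a Bohr set with $B''\subset B'_{\rho''}$. Let $A\subset B$ and $A'\subset B'$ have relative densities $\alpha=\beta(A)>0$ and $\alpha'=\beta'(A')>0$. If $\rho'\le c\alpha/d$ and $\rho''\le c\alpha'/k$, then at least one of the following holds. 1. There is a regular Bohr set $B'''$ of rank at most $k+C\alpha^{-1}\log(2\alpha'^{-1})$ such that $$\mu_{B'}(B''')\ge\left(\frac{\alpha}{2k\log(2\alpha'^{-1})}\right)^{C(k+\alpha^{-1}\log(2\alpha'^{-1}))}\quad\text{and}\quad \sup_{x\in G}|1_A*\beta'''(x)|\ge(1+c)\alpha.$$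 2. There are sets $L\subset B$ and $S\subset B''$ with $\beta(L)\ge c$ and $\beta''(S)\ge(\alpha'/2)^{C\alpha^{-1}}$ such that $$1_L*(1_S\,d\beta'')(x)\le C\alpha^{-1}\mu_{B'}(B'')^{-1}\;1_A*(1_{A'}\,d\beta')(x)\quad\text{for all }x\in G.$$ -/

import Mathlib

/-- A Bohr set of a finite abelian group `G`, given by its frequency set `Γ` and its width function
`δ : Γ → (0, 2]` (only the values of `width` on `freq` matter). Characters are homomorphisms from
`G` to the multiplicative monoid `ℂ`; as `G` is finite their values have modulus one. -/
structure BohrSet (G : Type*) [AddCommGroup G] where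
  freq : Finset (AddChar G ℂ)
  width : AddChar G ℂ → ℝ
  width_pos : ∀ γ ∈ freq, 0 < width γ
  width_le_two : ∀ γ ∈ freq, width γ ≤ 2

namespace BohrSet

variable {G : Type*} [AddCommGroup G]

open Classical in
/-- The underlying set `{x | |1 - γ(x)| ≤ δ_γ for all γ ∈ Γ}`. -/
noncomputable def carrier [Fintype G] (B : BohrSet G) : Finset G :=
  Finset.univ.filter fun x => ∀ γ ∈ B.freq, ‖1 - γ x‖ ≤ B.width γ

/-- The rank: the number of frequencies. -/
def rank (B : BohrSet G) : ℕ := B.freq.card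

/-- The dilate `B_ρ`, `ρ > 0`, with the same frequencies and width function `min (ρ δ) 2`. -/
noncomputable def dilate (B : BohrSet G) (ρ : ℝ) (hρ : 0 < ρ) : BohrSet G where
  freq := B.freq
  width := fun γ => min (ρ * B.width γ) 2
  width_pos := fun γ hγ => lt_min (mul_pos hρ (B.width_pos γ hγ)) two_pos
  width_le_two := fun _ _ => min_le_right _ _

/-- `B` is `d`-dimensional: `|B_{2ρ}| ≤ 2^d |B_ρ|` for all `ρ ∈ (0, 1]`. -/
def IsDimensional [Fintype G] (B : BohrSet G) (d : ℝ) : Prop :=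
  ∀ (ρ : ℝ) (hρ : 0 < ρ), ρ ≤ 1 →
    ((B.dilate (2 * ρ) (mul_pos two_pos hρ)).carrier.card : ℝ)
      ≤ (2 : ℝ) ^ d * ((B.dilate ρ hρ).carrier.card : ℝ)

/-- The Bohr set `B`, regarded as a `d`-dimensional Bohr set, is `C`-regular. -/
def IsRegularAt [Fintype G] (B : BohrSet G) (C d : ℝ) : Prop :=
  B.IsDimensional d ∧
  ∀ (η : ℝ) (hη : 0 < 1 + η), |η| ≤ 1 / (C * d) →
    1 / (1 + C * d * |η|)
        ≤ ((B.dilate (1 + η) hη).carrier.card : ℝ) / ((B.dilate 1 one_pos).carrier.card : ℝ) ∧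
    ((B.dilate (1 + η) hη).carrier.card : ℝ) / ((B.dilate 1 one_pos).carrier.card : ℝ)
        ≤ 1 + C * d * |η|

/-- `B` is `C`-regular: it is so with respect to every `d ≥ 1` for which it is `d`-dimensional. -/
def IsRegular [Fintype G] (B : BohrSet G) (C : ℝ) : Prop :=
  ∀ d : ℝ, 1 ≤ d → B.IsDimensional d → B.IsRegularAt C d

end BohrSet

/-- The indicator function `1_A`. -/
noncomputable def indFun {G : Type*} (A : Finset G) : G → ℝ :=
  Set.indicator (A : Set G) (fun _ => 1)

/-- The mass function of the uniform probability measure `μ_X` on `X`. -/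
noncomputable def unifMass {G : Type*} (X : Finset G) : G → ℝ :=
  fun y => (X.card : ℝ)⁻¹ * indFun X y

open Classical in
/-- `μ_X(Y)`, the relative density of `Y` in `X`. -/
noncomputable def relDensity {G : Type*} (X Y : Finset G) : ℝ :=
  ((Y ∩ X).card : ℝ) / (X.card : ℝ)

/-- The convolution `f ∗ ν` of a function `f` with the measure of mass function `ν`:
`(f ∗ ν)(x) = ∫ f(x - y) dν(y)`. -/
noncomputable def convMeas {G : Type*} [AddCommGroup G] [Fintype G] (f ν : G → ℝ) : G → ℝ :=
  fun x => ∑ y, f (x - y) * ν y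

/-! Put f = 1_A ∗ μ_{A'}, so that 0 ≤ f ≤ 1 and Σ f = α|B|. Everything depends on whether the
truncated mass Σ min(1, f/α) reaches |B|/36.

If it does, the Katz–Koester transform gives the second alternative (`exists_spread_sets`). Take m =
⌈1/α⌉ shifts x_i, let L be the part in B of the union of the A + x_i, and let S be the set of y in
B'' with every y + x_i in A'. If w - y ∈ L and y ∈ S, then some i has w - y - x_i ∈ A and y + x_i ∈
A'; hence 1_L ∗ 1_S ≤ m · 1_A ∗ 1_{A'} before normalisation. For shifts drawn from a slight
enlargement of B', the average of |S| times the size of the union is governed by Σ (1 - (1 - f)^m) ≥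
½ Σ min(1, f/α), so some choice makes both sets large (`exists_katz_koester`).

If it does not, f lives on large values and Σ f² ≥ 9α|A| (`le_sum_sq_of_sum_min_lt`). By Parseval
this energy comes from characters at which μ_{A'} has a coefficient of size at least √α. A Bohr set
E on which all of them are within 1/2 of 1 captures that energy, which forces sup 1_A ∗ μ_E ≥ 2α
(`two_mul_le_norm_convMeas`).

The set E comes from a local Chang theorem (`exists_isRegular_of_large_charSum`). Dissociation is
measured against the uniform measure on a small regular dilate; Riesz products bound the size of a
dissociated set Λ of large frequencies. If Λ is maximal, each large frequency is a {-1, 0,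
1}-combination of Λ up to a character with a large coefficient on that dilate, and regularity makes
such a character nearly constant further in. Adding Λ to the frequencies with small widths, and
passing to a regular dilate, gives E. -/

/-! ### Bohr sets: dilates, translates and covering -/

namespace BohrSet

variable {G : Type*} [AddCommGroup G] [Fintype G]

open Classical in
/-- The underlying set of the dilate `B_t`, for an arbitrary real `t`. -/
noncomputable def ball (B : BohrSet G) (t : ℝ) : Finset G :=
  Finset.univ.filter fun x => ∀ γ ∈ B.freq, ‖1 - γ x‖ ≤ t * B.width γ

lemma mem_ball {B : BohrSet G} {t : ℝ} {x : G} :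
    x ∈ B.ball t ↔ ∀ γ ∈ B.freq, ‖1 - γ x‖ ≤ t * B.width γ := by
  simp [ball]

lemma mem_carrier {B : BohrSet G} {x : G} :
    x ∈ B.carrier ↔ ∀ γ ∈ B.freq, ‖1 - γ x‖ ≤ B.width γ := by
  simp [carrier]

lemma norm_one_sub_le_two (γ : AddChar G ℂ) (x : G) : ‖1 - γ x‖ ≤ 2 := by
  calc ‖1 - γ x‖ ≤ ‖(1 : ℂ)‖ + ‖γ x‖ := norm_sub_le _ _
    _ = 2 := by rw [AddChar.norm_apply]; norm_num

lemma norm_one_sub_add_le (γ : AddChar G ℂ) (x y : G) :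
    ‖1 - γ (x + y)‖ ≤ ‖1 - γ x‖ + ‖1 - γ y‖ := by
  have h : 1 - γ (x + y) = (1 - γ x) + γ x * (1 - γ y) := by
    rw [AddChar.map_add_eq_mul]; ring
  rw [h]
  refine (norm_add_le _ _).trans ?_
  rw [norm_mul, AddChar.norm_apply, one_mul]

lemma norm_one_sub_neg (γ : AddChar G ℂ) (x : G) : ‖1 - γ (-x)‖ = ‖1 - γ x‖ := by
  have h : 1 - γ x = - (γ x * (1 - γ (-x))) := by
    have : γ x * γ (-x) = 1 := by rw [← AddChar.map_add_eq_mul]; simp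
    linear_combination -this
  rw [h, norm_neg, norm_mul, AddChar.norm_apply, one_mul]

lemma norm_one_sub_sub (γ : AddChar G ℂ) (x y : G) : ‖1 - γ (x - y)‖ = ‖γ x - γ y‖ := by
  have h : γ x - γ y = - (γ y * (1 - γ (x - y))) := by
    have : γ y * γ (x - y) = γ x := by rw [← AddChar.map_add_eq_mul]; simp
    linear_combination -this
  rw [h, norm_neg, norm_mul, AddChar.norm_apply, one_mul]

lemma carrier_eq_ball (B : BohrSet G) : B.carrier = B.ball 1 := by
  ext x; simp [mem_carrier, mem_ball]

lemma carrier_dilate (B : BohrSet G) (ρ : ℝ) (hρ : 0 < ρ) :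
    (B.dilate ρ hρ).carrier = B.ball ρ := by
  ext x
  simp only [mem_carrier, mem_ball, dilate, le_min_iff]
  exact forall₂_congr fun γ _ => and_iff_left (norm_one_sub_le_two γ x)

lemma ball_dilate (B : BohrSet G) {ρ : ℝ} (hρ : 0 < ρ) (hρ1 : ρ ≤ 1) (t : ℝ) :
    (B.dilate ρ hρ).ball t = B.ball (t * ρ) := by
  ext x
  simp only [mem_ball, dilate]
  refine forall₂_congr fun γ hγ => ?_
  have h1 := B.width_le_two γ hγ
  have h2 := B.width_pos γ hγ
  rw [min_eq_left (by nlinarith), mul_assoc]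

lemma zero_mem_ball (B : BohrSet G) {t : ℝ} (ht : 0 ≤ t) : (0 : G) ∈ B.ball t := by
  rw [mem_ball]
  intro γ hγ
  simpa using mul_nonneg ht (B.width_pos γ hγ).le

lemma card_ball_pos (B : BohrSet G) {t : ℝ} (ht : 0 ≤ t) : 0 < ((B.ball t).card : ℝ) := by
  exact_mod_cast Finset.card_pos.2 ⟨0, B.zero_mem_ball ht⟩

lemma card_carrier_pos (B : BohrSet G) : 0 < (B.carrier.card : ℝ) := by
  rw [carrier_eq_ball]; exact B.card_ball_pos zero_le_one

lemma ball_mono (B : BohrSet G) {s t : ℝ} (h : s ≤ t) : B.ball s ⊆ B.ball t := by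
  intro x
  simp only [mem_ball]
  intro hx γ hγ
  exact (hx γ hγ).trans (mul_le_mul_of_nonneg_right h (B.width_pos γ hγ).le)

lemma card_ball_mono (B : BohrSet G) {s t : ℝ} (h : s ≤ t) :
    ((B.ball s).card : ℝ) ≤ (B.ball t).card := by
  exact_mod_cast Finset.card_le_card (B.ball_mono h)

lemma add_mem_ball {B : BohrSet G} {s t : ℝ} {x y : G} (hx : x ∈ B.ball s) (hy : y ∈ B.ball t) :
    x + y ∈ B.ball (s + t) := by
  simp only [mem_ball] at *
  intro γ hγ
  have := norm_one_sub_add_le γ x y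
  have := hx γ hγ
  have := hy γ hγ
  linarith

lemma neg_mem_ball {B : BohrSet G} {t : ℝ} {x : G} (hx : x ∈ B.ball t) : -x ∈ B.ball t := by
  simp only [mem_ball] at *
  intro γ hγ
  rw [norm_one_sub_neg]; exact hx γ hγ

lemma sub_mem_ball {B : BohrSet G} {s t : ℝ} {x y : G} (hx : x ∈ B.ball s) (hy : y ∈ B.ball t) :
    x - y ∈ B.ball (s + t) := by
  rw [sub_eq_add_neg]; exact add_mem_ball hx (neg_mem_ball hy)

lemma isDimensional_iff {B : BohrSet G} {d : ℝ} : B.IsDimensional d ↔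
    ∀ ρ : ℝ, 0 < ρ → ρ ≤ 1 → ((B.ball (2 * ρ)).card : ℝ) ≤ 2 ^ d * (B.ball ρ).card := by
  simp only [IsDimensional, carrier_dilate]

lemma isRegularAt_iff {B : BohrSet G} {C d : ℝ} : B.IsRegularAt C d ↔ B.IsDimensional d ∧
    ∀ η : ℝ, 0 < 1 + η → |η| ≤ 1 / (C * d) →
      ((B.ball 1).card : ℝ) ≤ (1 + C * d * |η|) * (B.ball (1 + η)).card ∧
      ((B.ball (1 + η)).card : ℝ) ≤ (1 + C * d * |η|) * (B.ball 1).card := by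
  simp only [IsRegularAt, carrier_dilate]
  refine and_congr_right fun _ => forall_congr' fun η => forall₂_congr fun hη h => ?_
  have h1 := B.card_ball_pos (zero_le_one (α := ℝ))
  have h2 := B.card_ball_pos hη.le
  refine and_congr ?_ (div_le_iff₀ h1)
  -- The bound on |η| already excludes C * d < 0, so clearing denominators needs no sign hypothesis.
  have h3 : 0 < 1 + C * d * |η| := by
    by_cases hC : 0 ≤ C * d
    · positivity
    · have : 1 / (C * d) < 0 := one_div_neg.2 (not_le.1 hC)
      linarith [abs_nonneg η]
  rw [div_le_div_iff₀ h3 h1, one_mul, mul_comm]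

lemma IsDimensional.mono {B : BohrSet G} {d e : ℝ} (h : B.IsDimensional d) (hde : d ≤ e) :
    B.IsDimensional e := by
  rw [isDimensional_iff] at *
  intro ρ hρ hρ1
  refine (h ρ hρ hρ1).trans (mul_le_mul_of_nonneg_right ?_ (Nat.cast_nonneg _))
  exact Real.rpow_le_rpow_of_exponent_le one_le_two hde

lemma IsDimensional.dilate {B : BohrSet G} {d ρ : ℝ} (h : B.IsDimensional d) (hρ : 0 < ρ)
    (hρ1 : ρ ≤ 1) : (B.dilate ρ hρ).IsDimensional d := by
  rw [isDimensional_iff] at *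
  intro σ hσ hσ1
  rw [ball_dilate _ hρ hρ1, ball_dilate _ hρ hρ1, mul_assoc]
  exact h _ (by positivity) (by nlinarith)

lemma exists_isDimensional (B : BohrSet G) : ∃ d : ℝ, 1 ≤ d ∧ B.IsDimensional d := by
  obtain ⟨n, hn⟩ := pow_unbounded_of_one_lt ((Fintype.card G : ℝ)) (one_lt_two)
  refine ⟨max n 1, le_max_right _ _, IsDimensional.mono (d := n) ?_ (le_max_left _ _)⟩
  rw [isDimensional_iff]
  intro ρ hρ _
  have h1 : (1 : ℝ) ≤ (B.ball ρ).card := by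
    exact_mod_cast Finset.card_pos.2 ⟨0, B.zero_mem_ball hρ.le⟩
  have h2 : ((B.ball (2 * ρ)).card : ℝ) ≤ Fintype.card G := by
    exact_mod_cast Finset.card_le_univ _
  rw [Real.rpow_natCast]
  nlinarith

lemma isClosed_setOf_isDimensional (B : BohrSet G) : IsClosed {d : ℝ | B.IsDimensional d} := by
  simp only [isDimensional_iff, Set.ofPred_forall]
  refine isClosed_iInter fun ρ => isClosed_iInter fun _ => isClosed_iInter fun _ => ?_
  refine isClosed_le continuous_const ?_
  exact (Real.continuous_const_rpow two_ne_zero).mul continuous_const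

/-- There is a least `d ≥ 1` for which a Bohr set is `d`-dimensional. -/
lemma exists_least_isDimensional (B : BohrSet G) : ∃ d : ℝ, 1 ≤ d ∧ B.IsDimensional d ∧
    ∀ e : ℝ, 1 ≤ e → B.IsDimensional e → d ≤ e := by
  have hcl : IsClosed {d : ℝ | 1 ≤ d ∧ B.IsDimensional d} :=
    (isClosed_Ici (a := (1 : ℝ))).inter B.isClosed_setOf_isDimensional
  have hbd : BddBelow {d : ℝ | 1 ≤ d ∧ B.IsDimensional d} := ⟨1, fun d hd => hd.1⟩
  have := hcl.csInf_mem B.exists_isDimensional hbd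
  exact ⟨_, this.1, this.2, fun e he he' => csInf_le hbd ⟨he, he'⟩⟩

end BohrSet

open Classical in
/-- A set on which finitely many characters vary little is covered by few translates of a small
neighbourhood of `0`. -/
lemma card_le_pow_mul_card_of_norm_one_sub_le {G : Type*} [AddCommGroup G] [Fintype G]
    (T : Finset (AddChar G ℂ)) (h : AddChar G ℂ → ℝ) (hh : ∀ γ ∈ T, 0 < h γ) (N : ℕ)
    (X Y : Finset G) (hX : ∀ x ∈ X, ∀ γ ∈ T, ‖1 - γ x‖ ≤ N * h γ)
    (hY : ∀ y, (∀ γ ∈ T, ‖1 - γ y‖ ≤ 2 * h γ) → y ∈ Y) :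
    X.card ≤ ((2 * N + 1) ^ 2) ^ T.card * Y.card := by
  let cell : G → (T → ℤ × ℤ) := fun x γ =>
    (⌊(1 - γ.1 x).re / h γ⌋, ⌊(1 - γ.1 x).im / h γ⌋)
  have himg : X.image cell ⊆ Fintype.piFinset
      (fun _ : T => Finset.Icc (-(N : ℤ)) N ×ˢ Finset.Icc (-(N : ℤ)) N) := by
    intro c hc
    obtain ⟨x, hx, rfl⟩ := Finset.mem_image.1 hc
    rw [Fintype.mem_piFinset]
    intro γ
    have key : ∀ u : ℝ, |u| ≤ ‖1 - γ.1 x‖ → ⌊u / h γ⌋ ∈ Finset.Icc (-(N : ℤ)) N := by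
      intro u hu
      have h0 := hh γ.1 γ.2
      have h1 := abs_le.1 (hu.trans (hX x hx γ.1 γ.2))
      rw [Finset.mem_Icc]
      constructor
      · rw [Int.le_floor, le_div_iff₀ h0]; push_cast; linarith
      · have : u / h γ ≤ N := by rw [div_le_iff₀ h0]; exact h1.2
        exact_mod_cast (Int.floor_le _).trans this
    exact Finset.mem_product.2 ⟨key _ (Complex.abs_re_le_norm _), key _ (Complex.abs_im_le_norm _)⟩
  have hcard : (X.image cell).card ≤ ((2 * N + 1) ^ 2) ^ T.card := by
    refine (Finset.card_le_card himg).trans (le_of_eq ?_)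
    rw [Fintype.card_piFinset]
    simp only [Finset.card_product, Int.card_Icc, Finset.prod_const, Finset.card_univ,
      Fintype.card_coe]
    rw [show ((N : ℤ) + 1 - -(N : ℤ)).toNat = 2 * N + 1 by omega, sq]
  have hfib : ∀ c ∈ X.image cell, (X.filter fun x => cell x = c).card ≤ Y.card := by
    intro c hc
    obtain ⟨x₀, -, rfl⟩ := Finset.mem_image.1 hc
    refine Finset.card_le_card_of_injOn (fun x => x - x₀) ?_ (fun a _ b _ hab => sub_left_inj.1 hab)
    intro x hx
    have hx' := (Finset.mem_filter.1 hx).2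
    refine hY _ fun γ hγ => ?_
    have h0 := hh γ hγ
    have hc := Prod.ext_iff.1 (congrFun hx' ⟨γ, hγ⟩)
    have key : ∀ u v : ℝ, ⌊u / h γ⌋ = ⌊v / h γ⌋ → |u - v| ≤ h γ := by
      intro u v huv
      have h1 := Int.abs_sub_lt_one_of_floor_eq_floor huv
      rw [← sub_div, abs_div, abs_of_pos h0, div_lt_one h0] at h1
      exact h1.le
    rw [BohrSet.norm_one_sub_sub]
    have e : γ x - γ x₀ = (1 - γ x₀) - (1 - γ x) := by ring
    rw [e, norm_sub_rev]
    refine (Complex.norm_le_abs_re_add_abs_im _).trans ?_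
    rw [Complex.sub_re, Complex.sub_im]
    linarith [key _ _ hc.1, key _ _ hc.2]
  calc X.card ≤ Y.card * (X.image cell).card := Finset.card_le_mul_card_image X _ hfib
    _ ≤ Y.card * ((2 * N + 1) ^ 2) ^ T.card := Nat.mul_le_mul_left _ hcard
    _ = _ := mul_comm _ _

/-! ### Existence of regular dilates -/

/-- The increments of a monotone function over disjoint intervals add up to at most its total
increment. -/
lemma Monotone.sum_sub_le_of_pairwiseDisjoint {ι : Type*} {F : ℝ → ℝ} (hF : Monotone F)
    (l r : ι → ℝ) (a : ℝ) (v : Finset ι) :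
    ∀ b : ℝ, a ≤ b → (∀ i ∈ v, a ≤ l i ∧ l i < r i ∧ r i ≤ b) →
    (∀ i ∈ v, ∀ j ∈ v, i ≠ j → r i ≤ l j ∨ r j ≤ l i) →
    ∑ i ∈ v, (F (r i) - F (l i)) ≤ F b - F a := by
  classical
  -- Intervals are added in order of left endpoint: all earlier ones then lie in [a, l i], which is
  -- why b is kept general.
  induction v using Finset.induction_on_max_value l with
  | empty => intro b hab _ _; simpa using hF hab
  | insert i s hi hmax ih =>
    intro b _ hv hd
    rw [Finset.sum_insert hi]
    have hi' := hv i (Finset.mem_insert_self _ _)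
    have := ih (l i) hi'.1 (fun j hj => by
        have hj' := hv j (Finset.mem_insert_of_mem hj)
        refine ⟨hj'.1, hj'.2.1, ?_⟩
        rcases hd i (Finset.mem_insert_self _ _) j (Finset.mem_insert_of_mem hj)
          (fun h => hi (h ▸ hj)) with h | h
        · linarith [hmax j hj, hi'.2.1]
        · exact h)
      (fun j hj k hk => hd j (Finset.mem_insert_of_mem hj) k (Finset.mem_insert_of_mem hk))
    linarith [hF hi'.2.2]

open MeasureTheory in
/-- A maximal inequality: a monotone function has a point in the middle third of an interval at
which all its difference quotients are controlled by the average one. -/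
lemma Monotone.exists_forall_abs_sub_le {F : ℝ → ℝ} (hF : Monotone F) {a b κ : ℝ} (hab : a < b)
    (hκ : 18 * (F b - F a) < κ * (b - a)) :
    ∃ t : ℝ, a + (b - a) / 3 ≤ t ∧ t ≤ b - (b - a) / 3 ∧
      ∀ s : ℝ, a ≤ t + s → t + s ≤ b → |F (t + s) - F t| ≤ κ * |s| := by
  have hκ0 : 0 < κ := by
    have : 0 ≤ F b - F a := sub_nonneg.2 (hF hab.le)
    by_contra h
    nlinarith [mul_nonpos_of_nonpos_of_nonneg (not_lt.1 h) (sub_pos.2 hab).le]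
  by_contra! hcon
  set T : Set ℝ := Set.Icc (a + (b - a) / 3) (b - (b - a) / 3) with hT
  have hex : ∀ t : ℝ, ∃ s : ℝ, t ∈ T → a ≤ t + s ∧ t + s ≤ b ∧ κ * |s| < |F (t + s) - F t| := by
    intro t
    by_cases ht : t ∈ T
    · obtain ⟨s, hs⟩ := hcon t ht.1 ht.2
      exact ⟨s, fun _ => hs⟩
    · exact ⟨0, fun h => absurd h ht⟩
  choose s hs using hex
  -- Centre and radius of the interval with endpoints t and t + s t, over which F increases too
  -- fast.
  set x : ℝ → ℝ := fun t => t + s t / 2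
  set r : ℝ → ℝ := fun t => |s t| / 2
  have hbox : ∀ t ∈ T, a ≤ x t - r t ∧ x t + r t ≤ b ∧ 0 < r t ∧
      κ * (2 * r t) < F (x t + r t) - F (x t - r t) := by
    intro t ht
    obtain ⟨h1, h2, h3⟩ := hs t ht
    have hT1 := ht.1
    have hT2 := ht.2
    simp only [x, r]
    have hs0 : s t ≠ 0 := by
      intro h0; rw [h0] at h3; simp at h3
    rcases lt_or_gt_of_ne hs0 with h | h
    · rw [abs_of_neg h] at h3 ⊢
      have e1 : t + s t / 2 - -s t / 2 = t + s t := by ring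
      have e2 : t + s t / 2 + -s t / 2 = t := by ring
      rw [e1, e2]
      rw [abs_of_nonpos (sub_nonpos.2 (hF (by linarith)))] at h3
      refine ⟨h1, by linarith, by linarith, by linarith⟩
    · rw [abs_of_pos h] at h3 ⊢
      have e1 : t + s t / 2 - s t / 2 = t := by ring
      have e2 : t + s t / 2 + s t / 2 = t + s t := by ring
      rw [e1, e2]
      rw [abs_of_nonneg (sub_nonneg.2 (hF (by linarith)))] at h3
      refine ⟨by linarith, h2, by linarith, by linarith⟩
  obtain ⟨u, huT, hdisj, hcov⟩ := Vitali.exists_disjoint_subfamily_covering_enlargement_closedBall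
    T x r (b - a) (fun t ht => by have := hbox t ht; linarith) 5 (by norm_num)
  have hcover : T ⊆ ⋃ i ∈ u, Metric.ball (x i) (6 * r i) := by
    intro t ht
    obtain ⟨i, hi, hsub⟩ := hcov t ht
    have hmem : t ∈ Metric.closedBall (x t) (r t) := by
      rw [Metric.mem_closedBall, Real.dist_eq]
      simp only [x, r]
      rw [show t - (t + s t / 2) = -(s t / 2) by ring, abs_neg, abs_div, abs_two]
    -- Vitali's factor 5 is relaxed to 6 to get open balls, as compactness requires. These have
    -- length 12 r i against 2 r i for the original intervals, and the middle third costs a further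
    -- 3: hence 18 = 6 · 3.
    refine Set.mem_biUnion hi (Metric.closedBall_subset_ball ?_ (hsub hmem))
    have := (hbox i (huT hi)).2.2.1
    linarith
  obtain ⟨v, hvu, hvfin, hvcov⟩ := isCompact_Icc.elim_finite_subcover_image
    (fun i _ => Metric.isOpen_ball) hcover
  lift v to Finset ℝ using hvfin
  have hvol : (b - a) / 3 ≤ ∑ i ∈ v, 12 * r i := by
    have h1 : volume T ≤ ∑ i ∈ v, volume (Metric.ball (x i) (6 * r i)) :=
      (measure_mono hvcov).trans (measure_biUnion_finset_le v _)
    rw [hT, Real.volume_Icc] at h1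
    simp only [Real.volume_ball] at h1
    rw [← ENNReal.ofReal_sum_of_nonneg] at h1
    · rw [ENNReal.ofReal_le_ofReal_iff] at h1
      · have e : ∀ i, 2 * (6 * r i) = 12 * r i := fun i => by ring
        simp only [e] at h1
        linarith
      · exact Finset.sum_nonneg fun i hi => by
          have := (hbox i (huT (hvu hi))).2.2.1
          positivity
    · intro i hi
      have := (hbox i (huT (hvu hi))).2.2.1
      positivity
  have hsum := hF.sum_sub_le_of_pairwiseDisjoint (fun i => x i - r i) (fun i => x i + r i) a v b
    hab.le (fun i hi => by have := hbox i (huT (hvu hi)); exact ⟨this.1, by linarith, this.2.1⟩)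
    (fun i hi j hj hij => by
      have hd := hdisj (hvu hi) (hvu hj) hij
      rw [Function.onFun, Real.closedBall_eq_Icc, Real.closedBall_eq_Icc, Set.disjoint_left] at hd
      by_contra! hlt
      have hri := (hbox i (huT (hvu hi))).2.2.1
      have hrj := (hbox j (huT (hvu hj))).2.2.1
      refine hd (a := max (x i - r i) (x j - r j)) ⟨le_max_left _ _, ?_⟩ ⟨le_max_right _ _, ?_⟩
      · exact max_le (by linarith) hlt.1.le
      · exact max_le hlt.2.le (by linarith))
  have hlow : ∑ i ∈ v, κ * (2 * r i) ≤ ∑ i ∈ v, (F (x i + r i) - F (x i - r i)) :=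
    Finset.sum_le_sum fun i hi => (hbox i (huT (hvu hi))).2.2.2.le
  have e : ∑ i ∈ v, κ * (2 * r i) = κ / 6 * ∑ i ∈ v, 12 * r i := by
    rw [Finset.mul_sum]; exact Finset.sum_congr rfl fun i _ => by ring
  have := mul_le_mul_of_nonneg_left hvol (show (0 : ℝ) ≤ κ / 6 by positivity)
  nlinarith

namespace BohrSet

variable {G : Type*} [AddCommGroup G] [Fintype G]

/-- With d the least dimension at least 1 of the half dilate, |B_t| grows by at most 2^d on [1/2,
1]. On one of ⌈d⌉ equal pieces it therefore at most doubles, and the maximal inequality finds a good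
t in the middle third of that piece. -/
lemma exists_isRegular_dilate (B : BohrSet G) {C : ℝ} (hC : 80 ≤ C) :
    ∃ (t : ℝ) (ht : 0 < t), 1 / 2 ≤ t ∧ t ≤ 1 ∧ (B.dilate t ht).IsRegular C := by
  obtain ⟨d, hd1, hd, hmin⟩ := (B.dilate (1 / 2) one_half_pos).exists_least_isDimensional
  have hhalf : ((B.ball 1).card : ℝ) ≤ 2 ^ d * (B.ball (1 / 2)).card := by
    have := isDimensional_iff.1 hd 1 one_pos le_rfl
    rw [ball_dilate _ _ (by norm_num), ball_dilate _ _ (by norm_num)] at this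
    norm_num at this ⊢
    exact this
  set F : ℝ → ℝ := fun t => ((B.ball t).card : ℝ) with hFdef
  have hF : Monotone F := fun s t h => B.card_ball_mono h
  set n := ⌈d⌉₊ with hn
  have hn1 : d ≤ n := Nat.le_ceil d
  have hn2 : (n : ℝ) ≤ 2 * d := by
    have := Nat.ceil_lt_add_one (show 0 ≤ d by linarith)
    linarith
  have hn0 : (0 : ℝ) < n := by linarith
  obtain ⟨i, hi, hgrow⟩ : ∃ i < n, F (1 / 2 + (i + 1 : ℕ) / (2 * n)) ≤ 2 * F (1 / 2 + i / (2 * n)) := by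
    by_contra! hcon
    have hpow : ∀ j ≤ n, 0 < j → 2 ^ j * F (1 / 2) < F (1 / 2 + j / (2 * n)) := by
      intro j hj hj0
      induction j with
      | zero => omega
      | succ j ih =>
        have h1 := hcon j (by omega)
        rcases Nat.eq_zero_or_pos j with rfl | hjp
        · simpa using h1
        · have h2 := ih (by omega) hjp
          rw [pow_succ]; linarith
    have h1 := hpow n le_rfl (by exact_mod_cast hn0)
    have h2 : (1 / 2 + n / (2 * n) : ℝ) = 1 := by field_simp; norm_num
    rw [h2] at h1
    have h3 : (2 : ℝ) ^ d ≤ 2 ^ n := by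
      rw [← Real.rpow_natCast]; exact Real.rpow_le_rpow_of_exponent_le one_le_two hn1
    have h4 := mul_le_mul_of_nonneg_right h3 (Nat.cast_nonneg (B.ball (1 / 2)).card)
    simp only [hFdef] at h1
    linarith
  set a : ℝ := 1 / 2 + i / (2 * n) with ha
  set b : ℝ := 1 / 2 + (i + 1 : ℕ) / (2 * n) with hb
  have hba : b - a = 1 / (2 * n) := by rw [ha, hb]; push_cast; field_simp; ring
  have ha0 : 1 / 2 ≤ a := by rw [ha]; have : (0 : ℝ) ≤ i / (2 * n) := by positivity
                             linarith
  have hb1 : b ≤ 1 := by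
    have : ((i + 1 : ℕ) : ℝ) ≤ n := by exact_mod_cast hi
    have : ((i + 1 : ℕ) : ℝ) / (2 * n) ≤ 1 / 2 := by
      rw [div_le_div_iff₀ (by positivity) two_pos]; linarith
    rw [hb]; linarith
  have hFa : 0 < F a := B.card_ball_pos (by linarith)
  have hpos : 0 < 1 / (2 * (n : ℝ)) := by positivity
  -- Here 40 n beats the required 18 · 2n, and 40 n ≤ 80 d: this is the source of the threshold 80.
  obtain ⟨t, ht1, ht2, hreg⟩ := hF.exists_forall_abs_sub_le (a := a) (b := b)
    (κ := 40 * n * F a) (by linarith) (by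
      rw [hba]
      have : 40 * n * F a * (1 / (2 * n)) = 20 * F a := by field_simp; norm_num
      rw [this]; linarith)
  rw [hba] at ht1 ht2
  have ht0 : 0 < t := by linarith
  have htle : t ≤ 1 := by linarith
  refine ⟨t, ht0, by linarith, htle, fun e he hdim => ?_⟩
  -- As t ≥ 1/2, the half dilate is a dilate of B_t by a factor at most 1 and inherits each of its
  -- dimensions. So one estimate in terms of d serves every admissible e.
  have hde : d ≤ e := by
    refine hmin e he ?_
    rw [isDimensional_iff] at hdim ⊢
    intro ρ hρ hρ1
    have := hdim (ρ * (1 / 2) / t) (by positivity) (by rw [div_le_one ht0]; linarith)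
    rw [ball_dilate _ _ htle, ball_dilate _ _ htle] at this
    rw [ball_dilate _ _ (by norm_num), ball_dilate _ _ (by norm_num)]
    have e1 : 2 * (ρ * (1 / 2) / t) * t = 2 * ρ * (1 / 2) := by field_simp
    have e2 : ρ * (1 / 2) / t * t = ρ * (1 / 2) := by field_simp
    rwa [e1, e2] at this
  rw [isRegularAt_iff]
  refine ⟨hdim, fun η hη hηle => ?_⟩
  rw [ball_dilate _ _ htle, ball_dilate _ _ htle, one_mul]
  have hη6 : |η| ≤ 1 / (6 * n) := by
    refine hηle.trans (one_div_le_one_div_of_le (by positivity) ?_)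
    nlinarith
  have hs : |η * t| ≤ 1 / (6 * n) := by
    rw [abs_mul, abs_of_pos ht0]
    nlinarith [abs_nonneg η]
  have e6 : (1 / (2 * n) / 3 : ℝ) = 1 / (6 * n) := by field_simp; norm_num
  rw [e6] at ht1 ht2
  have hs' := abs_le.1 hs
  have h1 : a ≤ t + η * t := by linarith
  have h2 := hreg (η * t) h1 (by linarith)
  have e3 : (1 + η) * t = t + η * t := by ring
  rw [e3]
  change F t ≤ _ * F (t + η * t) ∧ F (t + η * t) ≤ _ * F t
  have hFt : F a ≤ F t := hF (by have := hpos; have : (0:ℝ) < 1 / (6 * n) := by positivity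
                                 linarith)
  have hFs : F a ≤ F (t + η * t) := hF h1
  have h3 : 40 * n * F a * |η * t| ≤ C * e * |η| * F a := by
    have hx : |η * t| ≤ |η| := by
      rw [abs_mul, abs_of_pos ht0]; exact mul_le_of_le_one_right (abs_nonneg _) htle
    have hy : 40 * n ≤ C * e := by nlinarith
    calc 40 * n * F a * |η * t| ≤ 40 * n * F a * |η| := by gcongr
      _ = 40 * n * |η| * F a := by ring
      _ ≤ C * e * |η| * F a := by gcongr
  have hnn : 0 ≤ C * e * |η| := by positivity
  have h4 := abs_le.1 (h2.trans h3)
  have h5 := mul_le_mul_of_nonneg_left hFt hnn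
  have h6 := mul_le_mul_of_nonneg_left hFs hnn
  constructor <;> linarith

end BohrSet

/-! ### Fourier analysis and Riesz products -/

section Fourier

variable {G : Type*}

lemma indFun_apply_of_mem {A : Finset G} {x : G} (h : x ∈ A) : indFun A x = 1 := by
  simp [indFun, h]

lemma indFun_apply_of_notMem {A : Finset G} {x : G} (h : x ∉ A) : indFun A x = 0 := by
  simp [indFun, h]

lemma indFun_nonneg (A : Finset G) (x : G) : 0 ≤ indFun A x := by
  by_cases h : x ∈ A <;> simp [indFun, h]

lemma sum_mul_indFun [Fintype G] (A : Finset G) (f : G → ℝ) :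
    ∑ x, f x * indFun A x = ∑ x ∈ A, f x := by
  classical
  simp [indFun, Set.indicator_apply]

lemma sum_indFun [Fintype G] (A : Finset G) : ∑ x, indFun A x = A.card := by
  have := sum_mul_indFun A (fun _ => 1)
  simpa using this

lemma unifMass_nonneg (X : Finset G) (x : G) : 0 ≤ unifMass X x :=
  mul_nonneg (by positivity) (indFun_nonneg _ _)

lemma sum_mul_unifMass [Fintype G] (A : Finset G) (f : G → ℝ) :
    ∑ x, f x * unifMass A x = (A.card : ℝ)⁻¹ * ∑ x ∈ A, f x := by
  rw [← sum_mul_indFun A f, Finset.mul_sum]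
  exact Finset.sum_congr rfl fun x _ => by rw [unifMass]; ring

lemma sum_unifMass [Fintype G] {X : Finset G} (hX : 0 < (X.card : ℝ)) : ∑ x, unifMass X x = 1 := by
  have := sum_mul_unifMass X (fun _ => 1)
  simp only [one_mul] at this
  rw [this]
  simp [hX.ne']

lemma unifMass_apply_of_mem {X : Finset G} {x : G} (h : x ∈ X) :
    unifMass X x = (X.card : ℝ)⁻¹ := by
  rw [unifMass, indFun_apply_of_mem h, mul_one]

lemma unifMass_apply_of_notMem {X : Finset G} {x : G} (h : x ∉ X) : unifMass X x = 0 := by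
  rw [unifMass, indFun_apply_of_notMem h, mul_zero]

lemma sum_insert_update_zsmul [AddCommGroup G] {Λ : Finset (AddChar G ℂ)} {γ : AddChar G ℂ} (hγ : γ ∉ Λ)
    (m : AddChar G ℂ → ℤ) (j : ℤ) :
    ∑ χ ∈ insert γ Λ, Function.update m γ j χ • χ = j • γ + ∑ χ ∈ Λ, m χ • χ := by
  rw [Finset.sum_insert hγ, Function.update_self]
  congr 1
  refine Finset.sum_congr rfl fun χ hχ => ?_
  rw [Function.update_of_ne (ne_of_mem_of_not_mem hχ hγ)]

lemma abs_update_le_one [AddCommGroup G] {m : AddChar G ℂ → ℤ} (hm : ∀ γ, |m γ| ≤ 1) (γ : AddChar G ℂ) {j : ℤ}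
    (hj : |j| ≤ 1) (χ : AddChar G ℂ) : |Function.update m γ j χ| ≤ 1 := by
  by_cases h : χ = γ
  · subst h; rwa [Function.update_self]
  · rw [Function.update_of_ne h]; exact hm χ

variable [AddCommGroup G] [Fintype G]

lemma convMeas_nonneg {f g : G → ℝ} (hf : ∀ x, 0 ≤ f x) (hg : ∀ x, 0 ≤ g x) (x : G) :
    0 ≤ convMeas f g x :=
  Finset.sum_nonneg fun _ _ => mul_nonneg (hf _) (hg _)

/-- The Fourier transform of a real function on a finite abelian group. -/
noncomputable def charSum (f : G → ℝ) (γ : AddChar G ℂ) : ℂ := ∑ x, (f x : ℂ) * γ x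

lemma charSum_zero (f : G → ℝ) : charSum f 0 = ((∑ x, f x : ℝ) : ℂ) := by
  simp [charSum]

lemma charSum_neg (f : G → ℝ) (γ : AddChar G ℂ) :
    charSum f (-γ) = starRingEnd ℂ (charSum f γ) := by
  simp only [charSum, map_sum, map_mul, Complex.conj_ofReal]
  refine Finset.sum_congr rfl fun x _ => ?_
  rw [AddChar.neg_apply, AddChar.map_neg_eq_conj]

lemma norm_charSum_le {f : G → ℝ} (hf : ∀ x, 0 ≤ f x) (γ : AddChar G ℂ) :
    ‖charSum f γ‖ ≤ ∑ x, f x := by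
  refine (norm_sum_le _ _).trans (le_of_eq (Finset.sum_congr rfl fun x _ => ?_))
  rw [norm_mul, AddChar.norm_apply, mul_one, Complex.norm_real, Real.norm_of_nonneg (hf x)]

lemma charSum_convMeas (f g : G → ℝ) (γ : AddChar G ℂ) :
    charSum (convMeas f g) γ = charSum f γ * charSum g γ := by
  simp only [charSum, convMeas, Complex.ofReal_sum, Finset.sum_mul]
  rw [Finset.sum_comm]
  simp only [Finset.mul_sum]
  conv_rhs => rw [Finset.sum_comm]
  refine Finset.sum_congr rfl fun y _ => ?_
  rw [← Equiv.sum_comp (Equiv.addRight y)]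
  refine Finset.sum_congr rfl fun x _ => ?_
  simp only [Equiv.coe_addRight, add_sub_cancel_right, AddChar.map_add_eq_mul]
  push_cast
  ring

lemma sum_convMeas (f g : G → ℝ) : ∑ x, convMeas f g x = (∑ x, f x) * ∑ x, g x := by
  have := charSum_convMeas f g 0
  simp only [charSum_zero] at this
  exact_mod_cast this

/-- Parseval's identity. -/
lemma sum_norm_sq_charSum (f : G → ℝ) :
    ∑ γ, ‖charSum f γ‖ ^ 2 = Fintype.card G * ∑ x, f x ^ 2 := by
  classical
  have key : ((∑ γ, ‖charSum f γ‖ ^ 2 : ℝ) : ℂ) = ((Fintype.card G * ∑ x, f x ^ 2 : ℝ) : ℂ) := by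
    push_cast
    have h1 : ∀ γ : AddChar G ℂ, (‖charSum f γ‖ : ℂ) ^ 2 =
        ∑ x, ∑ y, (f x : ℂ) * f y * γ (x - y) := by
      intro γ
      rw [← Complex.mul_conj', ← charSum_neg]
      simp only [charSum, Finset.sum_mul_sum]
      refine Finset.sum_congr rfl fun x _ => Finset.sum_congr rfl fun y _ => ?_
      rw [AddChar.neg_apply, sub_eq_add_neg, AddChar.map_add_eq_mul]
      ring
    simp only [h1]
    rw [Finset.sum_comm, Finset.mul_sum]
    refine Finset.sum_congr rfl fun x _ => ?_
    rw [Finset.sum_comm, Finset.sum_eq_single x]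
    · rw [← Finset.mul_sum, AddChar.sum_apply_eq_ite]
      simp; ring
    · intro y _ hy
      rw [← Finset.mul_sum, AddChar.sum_apply_eq_ite, if_neg (sub_ne_zero.2 hy.symm), mul_zero]
    · simp
  exact_mod_cast key

/-- A set of characters is dissociated relative to `g` if no nontrivial combination of its elements
with coefficients in `{-1, 0, 1}` has a large Fourier coefficient against `g`. -/
def IsDissociatedFrom (g : G → ℝ) (Λ : Finset (AddChar G ℂ)) : Prop :=
  ∀ m : AddChar G ℂ → ℤ, (∀ γ, |m γ| ≤ 1) → (∃ γ ∈ Λ, m γ ≠ 0) →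
    ‖charSum g (∑ γ ∈ Λ, m γ • γ)‖ ≤ 1 / 2

/-- A Riesz product, tested against the function `P` twisted by the character `ψ`. -/
noncomputable def rieszSum (P : G → ℝ) (c : AddChar G ℂ → ℂ) (Λ : Finset (AddChar G ℂ))
    (ψ : AddChar G ℂ) : ℂ :=
  ∑ x, (P x : ℂ) * ψ x * ∏ γ ∈ Λ, ((1 + (c γ * γ x).re : ℝ) : ℂ)

/-- Expand the new factor by Re z = (z + z̄)/2; conjugating γ x turns γ into -γ. -/
lemma rieszSum_insert (P : G → ℝ) (c : AddChar G ℂ → ℂ) {Λ : Finset (AddChar G ℂ)}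
    {γ : AddChar G ℂ} (hγ : γ ∉ Λ) (ψ : AddChar G ℂ) :
    rieszSum P c (insert γ Λ) ψ = rieszSum P c Λ ψ + c γ / 2 * rieszSum P c Λ (ψ + γ) +
      starRingEnd ℂ (c γ) / 2 * rieszSum P c Λ (ψ + -γ) := by
  simp only [rieszSum, Finset.mul_sum, ← Finset.sum_add_distrib]
  refine Finset.sum_congr rfl fun x _ => ?_
  rw [Finset.prod_insert hγ, AddChar.add_apply, AddChar.add_apply, AddChar.neg_apply,
    AddChar.map_neg_eq_conj]
  have : ((1 + (c γ * γ x).re : ℝ) : ℂ) =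
      1 + (c γ * γ x + starRingEnd ℂ (c γ) * starRingEnd ℂ (γ x)) / 2 := by
    rw [← map_mul, Complex.add_conj]; push_cast; ring
  rw [this]
  ring

lemma norm_rieszSum_insert_le (P : G → ℝ) {c : AddChar G ℂ → ℂ} (hc : ∀ γ, ‖c γ‖ ≤ 1)
    {Λ : Finset (AddChar G ℂ)} {γ : AddChar G ℂ} (hγ : γ ∉ Λ) (ψ : AddChar G ℂ) {a b : ℝ}
    (h0 : ‖rieszSum P c Λ ψ‖ ≤ a) (h1 : ‖rieszSum P c Λ (ψ + γ)‖ ≤ b)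
    (h2 : ‖rieszSum P c Λ (ψ + -γ)‖ ≤ b) :
    ‖rieszSum P c (insert γ Λ) ψ‖ ≤ a + b := by
  rw [rieszSum_insert P c hγ]
  have hb : 0 ≤ b := (norm_nonneg _).trans h1
  have e1 : ‖c γ / 2 * rieszSum P c Λ (ψ + γ)‖ ≤ 1 / 2 * b := by
    rw [norm_mul, norm_div, Complex.norm_two]
    gcongr
    exact hc γ
  have e2 : ‖starRingEnd ℂ (c γ) / 2 * rieszSum P c Λ (ψ + -γ)‖ ≤ 1 / 2 * b := by
    rw [norm_mul, norm_div, Complex.norm_two, Complex.norm_conj]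
    gcongr
    exact hc γ
  have := norm_add₃_le (a := rieszSum P c Λ ψ) (b := c γ / 2 * rieszSum P c Λ (ψ + γ))
    (c := starRingEnd ℂ (c γ) / 2 * rieszSum P c Λ (ψ + -γ))
  linarith

/-- Each factor has coefficients of total size at most 1 + 1/2 + 1/2 = 2, so the expanded product
has total weight at most 2 ^ |Λ|. -/
lemma norm_rieszSum_le (P : G → ℝ) {c : AddChar G ℂ → ℂ} (hc : ∀ γ, ‖c γ‖ ≤ 1) {κ : ℝ}
    (Λ : Finset (AddChar G ℂ)) : ∀ ψ : AddChar G ℂ, (∀ m : AddChar G ℂ → ℤ, (∀ γ, |m γ| ≤ 1) →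
      ‖charSum P (ψ + ∑ γ ∈ Λ, m γ • γ)‖ ≤ κ) → ‖rieszSum P c Λ ψ‖ ≤ 2 ^ Λ.card * κ := by
  induction Λ using Finset.induction_on with
  | empty =>
    intro ψ h
    have := h 0 (by simp)
    simpa [rieszSum, charSum] using this
  | insert γ Λ hγ ih =>
    intro ψ h
    have key : ∀ j : ℤ, |j| ≤ 1 → ‖rieszSum P c Λ (ψ + j • γ)‖ ≤ 2 ^ Λ.card * κ := by
      intro j hj
      refine ih _ fun m hm => ?_
      have := h (Function.update m γ j) (abs_update_le_one hm γ hj)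
      rwa [sum_insert_update_zsmul hγ, ← add_assoc] at this
    have h0 := key 0 (by simp)
    have h1 := key 1 (by simp)
    have h2 := key (-1) (by simp)
    simp only [zero_zsmul, add_zero, one_zsmul, neg_zsmul] at h0 h1 h2
    refine (norm_rieszSum_insert_le P hc hγ ψ h0 h1 h2).trans (le_of_eq ?_)
    rw [Finset.card_insert_of_notMem hγ, pow_succ]; ring

/-- Only the all-zero coefficient pattern can produce a term that is not small, and it contributes
at most 1. -/
lemma norm_rieszSum_zero_le {P : G → ℝ} (hP : ‖charSum P 0‖ ≤ 1) {c : AddChar G ℂ → ℂ}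
    (hc : ∀ γ, ‖c γ‖ ≤ 1) {κ : ℝ} (Λ : Finset (AddChar G ℂ)) (hκ : 0 ≤ κ)
    (h : ∀ m : AddChar G ℂ → ℤ, (∀ γ, |m γ| ≤ 1) → (∃ γ ∈ Λ, m γ ≠ 0) →
      ‖charSum P (∑ γ ∈ Λ, m γ • γ)‖ ≤ κ) :
    ‖rieszSum P c Λ 0‖ ≤ 1 + 2 ^ Λ.card * κ := by
  induction Λ using Finset.induction_on with
  | empty =>
    have : ‖rieszSum P c ∅ 0‖ ≤ 1 := by simpa [rieszSum, charSum] using hP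
    simp only [Finset.card_empty, pow_zero, one_mul]
    linarith
  | insert γ Λ hγ ih =>
    have key : ∀ j : ℤ, |j| ≤ 1 → j ≠ 0 → ‖rieszSum P c Λ (0 + j • γ)‖ ≤ 2 ^ Λ.card * κ := by
      intro j hj hj0
      refine norm_rieszSum_le P hc Λ _ fun m hm => ?_
      have := h (Function.update m γ j) (abs_update_le_one hm γ hj)
        ⟨γ, Finset.mem_insert_self _ _, by rwa [Function.update_self]⟩
      rwa [sum_insert_update_zsmul hγ, ← zero_add (j • γ)] at this
    have h0 := ih fun m hm ⟨χ, hχ, hχ0⟩ => by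
      have := h (Function.update m γ 0) (abs_update_le_one hm γ (by simp))
        ⟨χ, Finset.mem_insert_of_mem hχ, by
          rwa [Function.update_of_ne (ne_of_mem_of_not_mem hχ hγ)]⟩
      rwa [sum_insert_update_zsmul hγ, zero_zsmul, zero_add] at this
    have h1 := key 1 (by simp) (by simp)
    have h2 := key (-1) (by simp) (by simp)
    simp only [one_zsmul, neg_zsmul] at h1 h2
    refine (norm_rieszSum_insert_le P hc hγ 0 h0 h1 h2).trans (le_of_eq ?_)
    rw [Finset.card_insert_of_notMem hγ, pow_succ]; ring

/-- By convexity exp lies below its chord on [-t, t]. Taking out cosh t leaves a Riesz factor whose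
coefficient tanh t is less than 1 in modulus. -/
lemma Real.exp_mul_le_cosh_mul {t y : ℝ} (hy : |y| ≤ 1) :
    Real.exp (t * y) ≤ Real.cosh t * (1 + Real.tanh t * y) := by
  refine (mul_comm t y ▸ Real.exp_mul_le_cosh_add_mul_sinh hy t).trans (le_of_eq ?_)
  rw [Real.tanh_eq_sinh_div_cosh]
  have : Real.cosh t ≠ 0 := (Real.cosh_pos t).ne'
  field_simp

/-- Chang's bound for sets of characters that are dissociated relative to the measure `P`. -/
lemma exp_card_le_of_norm_charSum_le {P w : G → ℝ} (hP : ∀ x, 0 ≤ P x) (hP1 : ∑ x, P x ≤ 1)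
    (hw : ∀ x, 0 ≤ w x) (hw1 : ∑ x, w x = 1) {H : ℝ} (hH : 0 ≤ H) (hwP : ∀ x, w x ≤ H * P x)
    {ε : ℝ} (hε : 0 ≤ ε) {Λ : Finset (AddChar G ℂ)} (hΛ : ∀ γ ∈ Λ, ε ≤ ‖charSum w γ‖)
    (h : ∀ m : AddChar G ℂ → ℤ, (∀ γ, |m γ| ≤ 1) → (∃ γ ∈ Λ, m γ ≠ 0) →
      ‖charSum P (∑ γ ∈ Λ, m γ • γ)‖ ≤ (1 / 2) ^ Λ.card) :
    Real.exp (ε ^ 2 * Λ.card / 2) ≤ 2 * H := by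
  -- The phase that makes the coefficient real and nonnegative; it is 0 where the coefficient
  -- vanishes.
  set τ : AddChar G ℂ → ℂ := fun γ =>
    starRingEnd ℂ (charSum w γ) / (‖charSum w γ‖ : ℂ) with hτ
  have hτ1 : ∀ γ, ‖τ γ‖ ≤ 1 := by
    intro γ
    simp only [hτ, norm_div, Complex.norm_conj, Complex.norm_real, norm_norm]
    exact div_self_le_one _
  have hτw : ∀ γ, τ γ * charSum w γ = ‖charSum w γ‖ := by
    intro γ
    by_cases h0 : charSum w γ = 0
    · simp [h0]
    · have : (‖charSum w γ‖ : ℂ) ≠ 0 := by simpa using h0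
      simp only [hτ]
      rw [div_mul_eq_mul_div, div_eq_iff this, mul_comm, Complex.mul_conj']
      ring
  have hy : ∀ γ x, |(τ γ * γ x).re| ≤ 1 := by
    intro γ x
    refine (Complex.abs_re_le_norm _).trans ?_
    rw [norm_mul, AddChar.norm_apply, mul_one]; exact hτ1 γ
  have hmean : ε * Λ.card ≤ ∑ x, w x * ∑ γ ∈ Λ, (τ γ * γ x).re := by
    have : ∑ x, w x * ∑ γ ∈ Λ, (τ γ * γ x).re = ∑ γ ∈ Λ, ‖charSum w γ‖ := by
      simp only [Finset.mul_sum]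
      rw [Finset.sum_comm]
      refine Finset.sum_congr rfl fun γ _ => ?_
      have := congrArg Complex.re (hτw γ)
      rw [Complex.ofReal_re] at this
      rw [← this, charSum, Finset.mul_sum, Complex.re_sum]
      refine Finset.sum_congr rfl fun x _ => ?_
      rw [← Complex.re_ofReal_mul]; congr 1; ring
    rw [this, mul_comm, ← nsmul_eq_mul]
    exact Finset.card_nsmul_le_sum _ _ _ hΛ
  have htanh : |Real.tanh ε| ≤ 1 := (Real.abs_tanh_lt_one ε).le
  -- The exponential parameter is t = ε, which maximises the gain tε - t²/2 per character.
  set c : AddChar G ℂ → ℂ := fun γ => (Real.tanh ε : ℂ) * τ γ with hcdef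
  have hc : ∀ γ, ‖c γ‖ ≤ 1 := by
    intro γ
    simp only [hcdef, norm_mul, Complex.norm_real, Real.norm_eq_abs]
    exact mul_le_one₀ htanh (norm_nonneg _) (hτ1 γ)
  have hcre : ∀ γ x, (c γ * γ x).re = Real.tanh ε * (τ γ * γ x).re := by
    intro γ x
    simp only [hcdef]
    rw [mul_assoc, Complex.re_ofReal_mul]
  have hfac : ∀ γ x, 0 ≤ 1 + (c γ * γ x).re := by
    intro γ x
    have h1 := (Complex.abs_re_le_norm (c γ * γ x))
    rw [norm_mul, AddChar.norm_apply, mul_one] at h1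
    linarith [neg_abs_le (c γ * γ x).re, hc γ]
  have hexp : ∀ x, Real.exp (ε * ∑ γ ∈ Λ, (τ γ * γ x).re) ≤
      Real.exp (ε ^ 2 / 2) ^ Λ.card * ∏ γ ∈ Λ, (1 + (c γ * γ x).re) := by
    intro x
    rw [Finset.mul_sum, Real.exp_sum, ← Finset.prod_const, ← Finset.prod_mul_distrib]
    refine Finset.prod_le_prod (fun _ _ => (Real.exp_pos _).le) fun γ _ => ?_
    refine (Real.exp_mul_le_cosh_mul (hy γ x)).trans ?_
    rw [← hcre]
    exact mul_le_mul_of_nonneg_right (Real.cosh_le_exp_half_sq ε) (hfac γ x)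
  have hriesz : ∑ x, P x * ∏ γ ∈ Λ, (1 + (c γ * γ x).re) ≤ 2 := by
    have h1 := norm_rieszSum_zero_le (P := P) (c := c) (by
      rw [charSum_zero, Complex.norm_real,
        Real.norm_of_nonneg (Finset.sum_nonneg fun x _ => hP x)]
      exact hP1) hc Λ (by positivity) h
    have h2 : rieszSum P c Λ 0 = ((∑ x, P x * ∏ γ ∈ Λ, (1 + (c γ * γ x).re) : ℝ) : ℂ) := by
      simp only [rieszSum]
      push_cast
      simp
    rw [h2, Complex.norm_real, ← mul_pow] at h1
    norm_num at h1
    exact (le_abs_self _).trans h1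
  have hjensen : Real.exp (ε * ∑ x, w x * ∑ γ ∈ Λ, (τ γ * γ x).re) ≤
      ∑ x, w x * Real.exp (ε * ∑ γ ∈ Λ, (τ γ * γ x).re) := by
    have := convexOn_exp.map_sum_le (t := Finset.univ) (w := w)
      (p := fun x => ε * ∑ γ ∈ Λ, (τ γ * γ x).re) (fun x _ => hw x) hw1 (fun x _ => Set.mem_univ _)
    simp only [smul_eq_mul] at this
    refine le_trans (le_of_eq ?_) this
    congr 1
    rw [Finset.mul_sum]
    exact Finset.sum_congr rfl fun x _ => by ring
  have hmain : Real.exp (ε ^ 2 * Λ.card) ≤ Real.exp (ε ^ 2 / 2) ^ Λ.card * (2 * H) := by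
    calc Real.exp (ε ^ 2 * Λ.card)
        ≤ Real.exp (ε * ∑ x, w x * ∑ γ ∈ Λ, (τ γ * γ x).re) := by
          refine Real.exp_le_exp.2 ?_
          have := mul_le_mul_of_nonneg_left hmean hε
          linarith
      _ ≤ _ := hjensen
      _ ≤ ∑ x, (H * P x) *
            (Real.exp (ε ^ 2 / 2) ^ Λ.card * ∏ γ ∈ Λ, (1 + (c γ * γ x).re)) :=
          Finset.sum_le_sum fun x _ => mul_le_mul (hwP x) (hexp x) (Real.exp_pos _).le
            (mul_nonneg hH (hP x))
      _ = Real.exp (ε ^ 2 / 2) ^ Λ.card *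
            (H * ∑ x, P x * ∏ γ ∈ Λ, (1 + (c γ * γ x).re)) := by
          simp only [Finset.mul_sum]
          exact Finset.sum_congr rfl fun x _ => by ring
      _ ≤ Real.exp (ε ^ 2 / 2) ^ Λ.card * (2 * H) := by
          refine mul_le_mul_of_nonneg_left ?_ (by positivity)
          nlinarith
  rw [← Real.exp_nat_mul] at hmain
  have hsplit : Real.exp (ε ^ 2 * Λ.card) =
      Real.exp (Λ.card * (ε ^ 2 / 2)) * Real.exp (ε ^ 2 * Λ.card / 2) := by
    rw [← Real.exp_add]; congr 1; ring
  rw [hsplit] at hmain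
  exact le_of_mul_le_mul_left hmain (Real.exp_pos _)

end Fourier

/-! ### A local version of Chang's theorem -/

section Chang

variable {G : Type*} [AddCommGroup G] [Fintype G]

lemma charSum_iterate_convMeas (f g : G → ℝ) (n : ℕ) (γ : AddChar G ℂ) :
    charSum ((fun p => convMeas p g)^[n] f) γ = charSum f γ * charSum g γ ^ n := by
  induction n with
  | zero => simp
  | succ n ih => rw [Function.iterate_succ_apply', charSum_convMeas, ih, pow_succ, mul_assoc]

lemma sum_iterate_convMeas (f g : G → ℝ) (n : ℕ) :
    ∑ x, (fun p => convMeas p g)^[n] f x = (∑ x, f x) * (∑ x, g x) ^ n := by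
  have := charSum_iterate_convMeas f g n 0
  simp only [charSum_zero] at this
  exact_mod_cast this

lemma iterate_convMeas_nonneg {f g : G → ℝ} (hf : ∀ x, 0 ≤ f x) (hg : ∀ x, 0 ≤ g x) (n : ℕ) :
    ∀ x, 0 ≤ (fun p => convMeas p g)^[n] f x := by
  induction n with
  | zero => exact hf
  | succ n ih => rw [Function.iterate_succ_apply']; exact convMeas_nonneg ih hg

namespace BohrSet

/-- Smoothing the uniform measure on a large ball by measures on small balls does not change it in
the interior. -/
lemma iterate_convMeas_unifMass_ball (B : BohrSet G) {r s : ℝ} (hr : 0 ≤ r) (n : ℕ) :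
    ∀ t : ℝ, t + n * r ≤ s → ∀ x ∈ B.ball t,
      (fun p => convMeas p (unifMass (B.ball r)))^[n] (unifMass (B.ball s)) x =
        ((B.ball s).card : ℝ)⁻¹ := by
  induction n with
  | zero =>
    intro t ht x hx
    exact unifMass_apply_of_mem (B.ball_mono (by simpa using ht) hx)
  | succ n ih =>
    intro t ht x hx
    push_cast at ht
    rw [Function.iterate_succ_apply']
    simp only [convMeas]
    rw [sum_mul_unifMass, Finset.sum_congr rfl (fun y hy => ih (t + r) (by linarith) (x - y)
      (sub_mem_ball hx hy)), Finset.sum_const, nsmul_eq_mul, ← mul_assoc,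
      inv_mul_cancel₀ (B.card_ball_pos hr).ne', one_mul]

/-- The Riesz product bound needs a measure P dominating μ_A with coefficients at most 2^{-|Λ|} at
nontrivial combinations, while dissociation only gives 1/2. Convolving the uniform measure on the
ball of radius 1 + nr with n copies of that on the ball of radius r raises 1/2 to the n-th power and
leaves the density on B unchanged; regularity keeps the enlarged ball within twice the size of B. -/
lemma card_lt_of_isDissociatedFrom {B : BohrSet G} {C d r ε : ℝ} (hB : B.IsRegularAt C d)
    {n : ℕ} (hr : 0 ≤ r) (hnr : n * r ≤ 1 / (C * d)) (hCd : 0 < C * d) {A : Finset G}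
    (hA : A ⊆ B.carrier) (hA0 : 0 < relDensity B.carrier A) (hε : 0 < ε)
    {Λ : Finset (AddChar G ℂ)} (hΛ : ∀ γ ∈ Λ, ε ≤ ‖charSum (unifMass A) γ‖)
    (hdiss : IsDissociatedFrom (unifMass (B.ball r)) Λ) (hn : Λ.card ≤ n) :
    (Λ.card : ℝ) ≤ 4 * ((ε ^ 2)⁻¹ * Real.log (2 * (relDensity B.carrier A)⁻¹)) := by
  classical
  set α := relDensity B.carrier A with hα
  have hBpos := B.card_carrier_pos
  have hαA : α * B.carrier.card = A.card := by
    rw [hα, relDensity, Finset.inter_eq_left.2 hA, div_mul_cancel₀ _ hBpos.ne']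
  have hApos : 0 < (A.card : ℝ) := by rw [← hαA]; positivity
  have hα1 : α ≤ 1 := by
    rw [hα, relDensity, div_le_one hBpos]
    exact_mod_cast Finset.card_le_card Finset.inter_subset_right
  set X := B.ball (1 + n * r) with hX
  have hnr0 : 0 ≤ n * r := by positivity
  have hXpos : 0 < (X.card : ℝ) := B.card_ball_pos (by linarith)
  have hX2 : (X.card : ℝ) ≤ 2 * B.carrier.card := by
    have := ((isRegularAt_iff.1 hB).2 (n * r) (by linarith) (by rwa [abs_of_nonneg hnr0])).2
    rw [carrier_eq_ball]
    refine this.trans (mul_le_mul_of_nonneg_right ?_ (Nat.cast_nonneg _))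
    rw [abs_of_nonneg hnr0]
    rw [le_div_iff₀ hCd] at hnr
    linarith
  set b := unifMass (B.ball r) with hb
  have hb1 : ∑ x, b x = 1 := sum_unifMass (B.card_ball_pos hr)
  set P := (fun p => convMeas p b)^[n] (unifMass X) with hP
  have hP0 : ∀ x, 0 ≤ P x := iterate_convMeas_nonneg (unifMass_nonneg _) (unifMass_nonneg _) n
  have hPval : ∀ x ∈ B.carrier, P x = (X.card : ℝ)⁻¹ := by
    intro x hx
    rw [carrier_eq_ball] at hx
    exact B.iterate_convMeas_unifMass_ball hr n 1 le_rfl x hx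
  have hexp := exp_card_le_of_norm_charSum_le (P := P) (w := unifMass A) hP0
    (by rw [hP, sum_iterate_convMeas, sum_unifMass hXpos, hb1]; simp) (unifMass_nonneg _)
    (sum_unifMass hApos) (H := 2 / α) (by positivity) (fun x => by
      by_cases hx : x ∈ A
      · rw [unifMass_apply_of_mem hx, hPval x (hA hx), ← hαA, ← div_eq_mul_inv, div_div,
          inv_eq_one_div, div_le_div_iff₀ (by positivity) (by positivity)]
        nlinarith
      · rw [unifMass_apply_of_notMem hx]
        exact mul_nonneg (by positivity) (hP0 x)) hε.le hΛ (fun m hm hm0 => by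
      rw [hP, charSum_iterate_convMeas, norm_mul, norm_pow]
      have h1 : ‖charSum (unifMass X) (∑ γ ∈ Λ, m γ • γ)‖ ≤ 1 :=
        (norm_charSum_le (unifMass_nonneg _) _).trans (sum_unifMass hXpos).le
      have h2 := hdiss m hm hm0
      calc _ ≤ 1 * (1 / 2 : ℝ) ^ n := by gcongr
        _ ≤ (1 / 2) ^ Λ.card := by
          rw [one_mul]; exact pow_le_pow_of_le_one (by norm_num) (by norm_num) hn)
  have hlog := (Real.le_log_iff_exp_le (by positivity)).2 hexp
  have h4 : Real.log (2 * (2 / α)) ≤ 2 * Real.log (2 * α⁻¹) := by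
    have h5 : 2 * Real.log (2 * α⁻¹) = Real.log ((2 * α⁻¹) ^ 2) := by rw [Real.log_pow]; norm_cast
    rw [h5]
    refine Real.log_le_log (by positivity) ?_
    have : 1 ≤ α⁻¹ := (one_le_inv₀ hA0).2 hα1
    rw [div_eq_mul_inv]
    nlinarith
  have hε2 : 0 < ε ^ 2 := by positivity
  rw [← mul_assoc, mul_comm 4, mul_assoc, ← div_eq_inv_mul, le_div_iff₀ hε2]
  linarith

/-- A maximal dissociated set of large frequencies spans all large frequencies approximately. -/
lemma exists_isDissociatedFrom {g : G → ℝ} (hg : charSum g 0 = 1) (S : Set (AddChar G ℂ)) {n : ℕ}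
    (hS : ∀ Λ : Finset (AddChar G ℂ), (Λ : Set (AddChar G ℂ)) ⊆ S → IsDissociatedFrom g Λ →
      Λ.card ≤ n → Λ.card < n) :
    ∃ Λ : Finset (AddChar G ℂ), Λ.card < n ∧ ∀ γ ∈ S, ∃ m : AddChar G ℂ → ℤ,
      (∀ χ, |m χ| ≤ 1) ∧ 1 / 2 < ‖charSum g (γ + ∑ χ ∈ Λ, m χ • χ)‖ := by
  classical
  -- Subsets of dissociated sets are dissociated (extend m by 0), so a set of size n or more would
  -- contain a forbidden one of size exactly n.
  have hS' : ∀ Λ : Finset (AddChar G ℂ), (Λ : Set (AddChar G ℂ)) ⊆ S → IsDissociatedFrom g Λ →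
      Λ.card < n := by
    intro Λ hΛ hd
    by_contra! hlt
    obtain ⟨Λ', hsub, hcard⟩ := Finset.exists_subset_card_eq hlt
    refine absurd (hS Λ' (fun x hx => hΛ (hsub hx)) ?_ hcard.le) (by omega)
    intro m hm ⟨γ, hγ, hγ0⟩
    have := hd (fun χ => if χ ∈ Λ' then m χ else 0)
      (fun χ => by split_ifs; exacts [hm χ, by simp]) ⟨γ, hsub hγ, by rwa [if_pos hγ]⟩
    simp only [ite_smul, zero_zsmul] at this
    rwa [Finset.sum_ite_mem, Finset.inter_eq_right.2 hsub] at this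
  obtain ⟨Λ, hΛ, hmax⟩ := (Finset.univ.filter fun Λ : Finset (AddChar G ℂ) =>
    (Λ : Set (AddChar G ℂ)) ⊆ S ∧ IsDissociatedFrom g Λ).exists_max_image Finset.card
    ⟨∅, by simp [IsDissociatedFrom]⟩
  simp only [Finset.mem_filter, Finset.mem_univ, true_and] at hΛ hmax
  refine ⟨Λ, hS' Λ hΛ.1 hΛ.2, fun γ hγ => ?_⟩
  by_cases hmem : γ ∈ Λ
  · refine ⟨fun χ => if χ = γ then -1 else 0, fun χ => by dsimp only; split_ifs <;> simp, ?_⟩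
    simp only [ite_smul, zero_zsmul, neg_zsmul, one_zsmul]
    rw [Finset.sum_ite_eq_of_mem' _ _ _ hmem, add_neg_cancel, hg]
    norm_num
  · have hnot : ¬ IsDissociatedFrom g (insert γ Λ) := by
      intro hd
      have := hmax (insert γ Λ) ⟨by
        rw [Finset.coe_insert]; exact Set.insert_subset hγ hΛ.1, hd⟩
      rw [Finset.card_insert_of_notMem hmem] at this
      omega
    simp only [IsDissociatedFrom] at hnot
    push Not at hnot
    obtain ⟨m, hm, ⟨χ, hχ, hχ0⟩, hlarge⟩ := hnot
    rw [Finset.sum_insert hmem] at hlarge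
    have hmγ : m γ ≠ 0 := by
      intro h0
      rw [h0, zero_zsmul, zero_add] at hlarge
      refine absurd (hΛ.2 m hm ⟨χ, ?_, hχ0⟩) (not_le.2 hlarge)
      exact (Finset.mem_insert.1 hχ).resolve_left (fun h => hχ0 (h ▸ h0))
    rcases (by have := abs_le.1 (hm γ); omega : m γ = 1 ∨ m γ = -1) with h1 | h1
    · refine ⟨m, hm, ?_⟩
      rwa [h1, one_zsmul] at hlarge
    -- Negating the character conjugates the coefficient and keeps its norm.
    · refine ⟨fun χ => - m χ, fun χ => by rw [abs_neg]; exact hm χ, ?_⟩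
      rw [h1, neg_zsmul, one_zsmul] at hlarge
      simp only [neg_zsmul, Finset.sum_neg_distrib]
      rw [← Complex.norm_conj, ← charSum_neg]
      rwa [neg_add, neg_neg]

/-- A character that is not orthogonal to a regular Bohr set is nearly constant on small
dilates of it. -/
lemma norm_one_sub_le_of_charSum {B : BohrSet G} {C d η : ℝ} (hB : B.IsRegularAt C d)
    (hη0 : 0 ≤ η) (hCd : 0 < C * d) (hη : 16 * (C * d) * η ≤ 1) {ψ : AddChar G ℂ}
    (hψ : 1 / 2 < ‖charSum (unifMass B.carrier) ψ‖) {x : G} (hx : x ∈ B.ball η) :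
    ‖1 - ψ x‖ ≤ 1 / 4 := by
  classical
  set X := B.carrier with hX
  have hXpos : 0 < (X.card : ℝ) := B.card_carrier_pos
  set Y := X.image (fun y => y + x) with hY
  have hYX : Y.card = X.card := Finset.card_image_of_injective _ (add_left_injective x)
  have hYsub : X ∪ Y ⊆ B.ball (1 + η) := by
    have hX1 : X = B.ball 1 := B.carrier_eq_ball
    refine Finset.union_subset (hX1 ▸ B.ball_mono (by linarith)) ?_
    intro z hz
    obtain ⟨y, hy, rfl⟩ := Finset.mem_image.1 hz
    exact add_mem_ball (hX1 ▸ hy) hx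
  have hcard : ((X ∪ Y).card : ℝ) ≤ (1 + C * d * η) * X.card := by
    have h1 := ((isRegularAt_iff.1 hB).2 η (by linarith) (by
      rw [abs_of_nonneg hη0, le_div_iff₀ hCd]; nlinarith)).2
    rw [abs_of_nonneg hη0, ← carrier_eq_ball] at h1
    exact le_trans (by exact_mod_cast Finset.card_le_card hYsub) h1
  -- Multiplying the sum by ψ x translates X to Y = X + x. Regularity bounds each difference set by
  -- C d η |X|, while the sum over X exceeds |X|/2 by hypothesis.
  have hid : (1 - ψ x) * ∑ y ∈ X, ψ y = ∑ y ∈ X \ Y, ψ y - ∑ y ∈ Y \ X, ψ y := by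
    have h1 : ψ x * ∑ y ∈ X, ψ y = ∑ y ∈ Y, ψ y := by
      rw [hY, Finset.sum_image (fun a _ b _ h => add_left_injective x h), Finset.mul_sum]
      exact Finset.sum_congr rfl fun y _ => by rw [AddChar.map_add_eq_mul, mul_comm]
    rw [sub_mul, one_mul, h1]
    exact (Finset.sum_sdiff_sub_sum_sdiff ..).symm
  have hnorm : ∀ Z : Finset G, ‖∑ y ∈ Z, ψ y‖ ≤ Z.card := by
    intro Z
    refine (norm_sum_le _ _).trans ?_
    simp
  have hlow : (X.card : ℝ) / 2 ≤ ‖∑ y ∈ X, ψ y‖ := by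
    have : charSum (unifMass X) ψ = (X.card : ℂ)⁻¹ * ∑ y ∈ X, ψ y := by
      simp only [charSum, unifMass, indFun, Set.indicator_apply, Finset.mem_coe, mul_ite, mul_one,
        mul_zero, Complex.ofReal_inv, Complex.ofReal_natCast, apply_ite Complex.ofReal,
        Complex.ofReal_zero, ite_mul, zero_mul, Finset.sum_ite_mem, Finset.univ_inter,
        Finset.mul_sum]
    rw [this, norm_mul, norm_inv, Complex.norm_natCast, ← div_eq_inv_mul, lt_div_iff₀ hXpos] at hψ
    linarith
  have h1 : ((X \ Y).card : ℝ) + Y.card = (X ∪ Y).card := by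
    exact_mod_cast Finset.card_sdiff_add_card X Y
  have h2 : ((Y \ X).card : ℝ) + X.card = (X ∪ Y).card := by
    rw [Finset.union_comm]; exact_mod_cast Finset.card_sdiff_add_card Y X
  rw [hYX] at h1
  have h3 := congrArg norm hid
  rw [norm_mul] at h3
  have h4 := (norm_sub_le (∑ y ∈ X \ Y, ψ y) (∑ y ∈ Y \ X, ψ y)).trans
    (add_le_add (hnorm _) (hnorm _))
  have h5 := mul_le_mul_of_nonneg_left hlow (norm_nonneg (1 - ψ x))
  have h6 : ‖1 - ψ x‖ * X.card ≤ 4 * (C * d * η) * X.card := by linarith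
  have h7 := le_of_mul_le_mul_right h6 hXpos
  linarith

end BohrSet

lemma norm_one_sub_sum_zsmul_le (Λ : Finset (AddChar G ℂ)) {m : AddChar G ℂ → ℤ}
    (hm : ∀ γ, |m γ| ≤ 1) (x : G) :
    ‖1 - (∑ γ ∈ Λ, m γ • γ) x‖ ≤ ∑ γ ∈ Λ, ‖1 - γ x‖ := by
  classical
  induction Λ using Finset.induction_on with
  | empty => simp
  | insert γ Λ hγ ih =>
    rw [Finset.sum_insert hγ, Finset.sum_insert hγ, AddChar.add_apply]
    have h1 : ‖1 - (m γ • γ) x‖ ≤ ‖1 - γ x‖ := by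
      rcases (by have := abs_le.1 (hm γ); omega : m γ = 0 ∨ m γ = 1 ∨ m γ = -1) with h | h | h
      · rw [h, zero_zsmul]; simp
      · rw [h, one_zsmul]
      · rw [h, neg_zsmul, one_zsmul, AddChar.neg_apply, BohrSet.norm_one_sub_neg]
    have h2 : 1 - (m γ • γ) x * (∑ γ ∈ Λ, m γ • γ) x =
        (1 - (m γ • γ) x) + (m γ • γ) x * (1 - (∑ γ ∈ Λ, m γ • γ) x) := by ring
    rw [h2]
    refine (norm_add_le _ _).trans ?_
    rw [norm_mul, AddChar.norm_apply, one_mul]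
    exact add_le_add h1 ih

namespace BohrSet

open Classical in
/-- The Bohr set obtained from `B` by shrinking its widths by the factor `ρ` and adding the
frequencies in `Λ` with width `τ`. -/
noncomputable def refineBy (B : BohrSet G) (Λ : Finset (AddChar G ℂ)) {ρ τ : ℝ} (hρ0 : 0 < ρ)
    (hρ1 : ρ ≤ 1) (hτ0 : 0 < τ) (hτ2 : τ ≤ 2) : BohrSet G where
  freq := B.freq ∪ Λ
  width := fun γ => if γ ∈ B.freq then ρ * B.width γ else τ
  width_pos := fun γ _ => by
    split_ifs with h
    · exact mul_pos hρ0 (B.width_pos γ h)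
    · exact hτ0
  width_le_two := fun γ _ => by
    split_ifs with h
    · nlinarith [B.width_le_two γ h, B.width_pos γ h]
    · exact hτ2

section RefineBy

variable (B : BohrSet G) (Λ : Finset (AddChar G ℂ)) {ρ τ : ℝ} (hρ0 : 0 < ρ) (hρ1 : ρ ≤ 1)
  (hτ0 : 0 < τ) (hτ2 : τ ≤ 2)

lemma ball_refineBy_subset : (B.refineBy Λ hρ0 hρ1 hτ0 hτ2).ball 1 ⊆ B.ball ρ := by
  classical
  intro x hx
  rw [mem_ball] at hx ⊢
  intro γ hγ
  have := hx γ (Finset.mem_union_left _ hγ)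
  simpa [refineBy, hγ] using this

/-- A frequency of Λ already present in B keeps its shrunken width, which is at most 2ρ; hence the
hypothesis on τ. -/
lemma norm_one_sub_le_of_mem_ball_refineBy (hρτ : 2 * ρ ≤ τ) {x : G}
    (hx : x ∈ (B.refineBy Λ hρ0 hρ1 hτ0 hτ2).ball 1) {γ : AddChar G ℂ} (hγ : γ ∈ Λ) :
    ‖1 - γ x‖ ≤ τ := by
  classical
  have := mem_ball.1 hx γ (Finset.mem_union_right _ hγ)
  rw [one_mul] at this
  refine this.trans ?_
  simp only [refineBy]
  split_ifs with h
  · nlinarith [B.width_le_two γ h]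
  · exact le_rfl

/-- Covering with cells of a quarter of the width puts differences in the half dilate, which leaves
room to pass to a regular dilate later. New frequencies need only the trivial bound 2. -/
lemma card_carrier_le_pow_mul_card_refineBy {N : ℕ} (hNρ : 4 ≤ N * ρ) (hNτ : 8 ≤ N * τ) :
    (B.carrier.card : ℝ) ≤ ((2 * N + 1) ^ 2) ^ (B.refineBy Λ hρ0 hρ1 hτ0 hτ2).rank *
      ((B.refineBy Λ hρ0 hρ1 hτ0 hτ2).ball (1 / 2)).card := by
  classical
  set E := B.refineBy Λ hρ0 hρ1 hτ0 hτ2 with hE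
  have hcov := card_le_pow_mul_card_of_norm_one_sub_le E.freq (fun γ => E.width γ / 4)
    (fun γ hγ => div_pos (E.width_pos γ hγ) (by norm_num)) N B.carrier (E.ball (1 / 2))
    (fun x hx γ hγ => by
      rw [hE, refineBy]
      dsimp only
      split_ifs with h
      · refine (mem_carrier.1 hx γ h).trans ?_
        nlinarith [B.width_pos γ h]
      · refine (norm_one_sub_le_two γ x).trans ?_
        linarith)
    (fun y hy => by
      rw [mem_ball]
      intro γ hγ
      have := hy γ hγ
      linarith)
  exact_mod_cast hcov

end RefineBy


/-- The characters at which a dense subset of a regular Bohr set has a large Fourier coefficient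
are, up to characters that are nearly trivial on a dilate, spanned by a few of them. -/
lemma exists_approx_span_of_large_charSum {C d D : ℝ} (hC : 80 ≤ C) {B : BohrSet G}
    (hd0 : 0 < d) (hdD : d ≤ D) (hD1 : 1 ≤ D) (hB : B.IsRegularAt C d) {A : Finset G}
    (hA : A ⊆ B.carrier) (hA0 : 0 < relDensity B.carrier A) {ε q : ℝ} (hε : 0 < ε)
    (hq : q = (ε ^ 2)⁻¹ * Real.log (2 * (relDensity B.carrier A)⁻¹)) {n : ℕ}
    (hn : n = ⌊4 * q⌋₊ + 1) :
    ∃ (Λ : Finset (AddChar G ℂ)) (ρ : ℝ), 0 < ρ ∧ 1 / (32 * (C * D) ^ 2 * n) ≤ ρ ∧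
      ρ * (8 * n) ≤ 1 ∧ Λ.card < n ∧ ∀ γ, ε ≤ ‖charSum (unifMass A) γ‖ →
        ∃ m : AddChar G ℂ → ℤ, (∀ χ, |m χ| ≤ 1) ∧
          ∀ x ∈ B.ball ρ, ‖1 - (γ + ∑ χ ∈ Λ, m χ • χ) x‖ ≤ 1 / 4 := by
  have hn1 : (1 : ℝ) ≤ n := by rw [hn]; push_cast; linarith [Nat.cast_nonneg (α := ℝ) ⌊4 * q⌋₊]
  have hCd : 0 < C * d := by positivity
  have hCD : 80 ≤ C * D := by nlinarith
  -- Chosen so that n smoothing steps stay within the range 1/(C D) of regularity. The dimension D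
  -- replaces d because `IsRegular` speaks only of dimensions at least 1.
  set r₀ : ℝ := 1 / (n * (C * D)) with hr₀
  have hr₀pos : 0 < r₀ := by positivity
  have hr₀1 : r₀ ≤ 1 := by
    rw [hr₀, div_le_one (by positivity)]; nlinarith
  obtain ⟨t, ht0, ht2, ht1, hreg⟩ := (B.dilate r₀ hr₀pos).exists_isRegular_dilate hC
  set B₁ := (B.dilate r₀ hr₀pos).dilate t ht0 with hB₁
  have hB₁ball : ∀ s, B₁.ball s = B.ball (s * (t * r₀)) := by
    intro s
    rw [hB₁, ball_dilate _ _ ht1, ball_dilate _ _ hr₀1, mul_assoc]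
  have hB₁reg : B₁.IsRegularAt C D :=
    hreg D hD1 (((hB.1.mono hdD).dilate hr₀pos hr₀1).dilate ht0 ht1)
  have hB₁car : B₁.carrier = B.ball (t * r₀) := by rw [carrier_eq_ball, hB₁ball, one_mul]
  have hr : 0 < t * r₀ := mul_pos ht0 hr₀pos
  have hnr : n * (t * r₀) ≤ 1 / (C * D) := by
    have h1 : n * r₀ = 1 / (C * D) := by rw [hr₀]; field_simp
    rw [← h1, mul_left_comm]
    exact mul_le_of_le_one_left (by positivity) ht1
  obtain ⟨Λ, hΛn, hΛ⟩ := exists_isDissociatedFrom (g := unifMass B₁.carrier)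
    (by rw [charSum_zero, sum_unifMass B₁.card_carrier_pos]; simp)
    {γ | ε ≤ ‖charSum (unifMass A) γ‖} (n := n) (fun Λ hΛ hdiss hcard => by
      have := card_lt_of_isDissociatedFrom hB hr.le
        (hnr.trans (one_div_le_one_div_of_le hCd (by gcongr))) hCd hA hA0 hε hΛ
        (by rwa [← hB₁car]) hcard
      rw [← hq] at this
      rw [hn]
      exact Nat.lt_succ_of_le (Nat.le_floor this))
  set η : ℝ := 1 / (16 * (C * D)) with hη
  have hη0 : 0 < η := by positivity
  set ρ : ℝ := η * (t * r₀) with hρ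
  have hρ0 : 0 < ρ := by positivity
  have hρn : ρ * (8 * n) ≤ 1 := by
    have h1 : η ≤ 1 / 8 := by
      rw [hη]; exact one_div_le_one_div_of_le (by norm_num) (by linarith)
    have h2 : n * (t * r₀) ≤ 1 := hnr.trans (by rw [div_le_one (by positivity)]; linarith)
    have h3 : 0 ≤ n * (t * r₀) := by positivity
    calc ρ * (8 * n) = η * (8 * (n * (t * r₀))) := by rw [hρ]; ring
      _ ≤ 1 / 8 * (8 * 1) := by gcongr
      _ = 1 := by norm_num
  refine ⟨Λ, ρ, hρ0, ?_, hρn, hΛn, fun γ hγ => ?_⟩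
  · have h1 : 1 / (32 * (C * D) ^ 2 * n) = η * (1 / 2 * r₀) := by
      rw [hη, hr₀]; field_simp; norm_num
    rw [h1, hρ]
    gcongr
  · obtain ⟨m, hm, hlarge⟩ := hΛ γ hγ
    refine ⟨m, hm, fun x hx => ?_⟩
    refine norm_one_sub_le_of_charSum hB₁reg hη0.le (by linarith) ?_ hlarge
      (by rw [hB₁ball]; exact hx)
    rw [hη, mul_one_div_cancel (by positivity)]

/-- **Local Chang theorem.** The characters at which a dense subset of a regular Bohr set has a
large Fourier coefficient are nearly trivial on a large regular Bohr set of small rank. -/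
theorem exists_isRegular_of_large_charSum {K C : ℝ} (hK : 0 < K) (hC : 80 ≤ C) {B : BohrSet G}
    {k : ℕ} (hk : 1 ≤ k) (hrank : B.rank = k) {d : ℝ} (hd0 : 0 < d) (hd : d ≤ K * k)
    (hB : B.IsRegularAt C d) {A : Finset G} (hA : A ⊆ B.carrier)
    (hA0 : 0 < relDensity B.carrier A) {ε q : ℝ} (hε : 0 < ε)
    (hq : q = (ε ^ 2)⁻¹ * Real.log (2 * (relDensity B.carrier A)⁻¹)) (hq1 : 1 / 2 ≤ q) :
    ∃ E : BohrSet G, E.IsRegular C ∧ (E.rank : ℝ) ≤ k + 4 * q ∧ E.carrier ⊆ B.carrier ∧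
      (B.carrier.card : ℝ) ≤
        (3840 * C ^ 2 * (K + 1) ^ 2 * k ^ 2 * q) ^ (2 * (k + 4 * q)) * E.carrier.card ∧
      ∀ γ, ε ≤ ‖charSum (unifMass A) γ‖ → ∀ x ∈ E.carrier, ‖1 - γ x‖ ≤ 1 / 2 := by
  classical
  have hk1 : (1 : ℝ) ≤ k := by exact_mod_cast hk
  set n : ℕ := ⌊4 * q⌋₊ + 1 with hn
  have hn1 : (1 : ℝ) ≤ n := by rw [hn]; push_cast; linarith [Nat.cast_nonneg (α := ℝ) ⌊4 * q⌋₊]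
  have hnq : (n : ℝ) ≤ 6 * q := by
    rw [hn]; push_cast
    have := Nat.floor_le (show 0 ≤ 4 * q by linarith)
    linarith
  set D : ℝ := (K + 1) * k with hD
  have hD1 : 1 ≤ D := by rw [hD]; nlinarith
  have hdD : d ≤ D := by rw [hD]; nlinarith
  have hCD : 1 ≤ (C * D) ^ 2 := one_le_pow₀ (by nlinarith)
  obtain ⟨Λ, ρ, hρ0, hρlow, hρn, hΛn, hΛ⟩ :=
    exists_approx_span_of_large_charSum hC hd0 hdD hD1 hB hA hA0 hε hq hn
  have hρ1 : ρ ≤ 1 := by nlinarith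
  -- Fewer than n frequencies of Λ then move a combination by at most 1/4, and the remaining
  -- character contributes another 1/4.
  set τ : ℝ := 1 / (4 * n) with hτ
  have hτ0 : 0 < τ := by positivity
  have hτ2 : τ ≤ 2 := by rw [hτ, div_le_iff₀ (by positivity)]; linarith
  have hρτ : 2 * ρ ≤ τ := by rw [hτ, le_div_iff₀ (by positivity)]; linarith
  set E := B.refineBy Λ hρ0 hρ1 hτ0 hτ2 with hE
  have hEcard : (E.rank : ℝ) ≤ k + 4 * q := by
    have h1 : (E.rank : ℝ) ≤ B.rank + Λ.card := by
      exact_mod_cast Finset.card_union_le B.freq Λ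
    have h3 : (Λ.card : ℝ) ≤ 4 * q :=
      (Nat.le_floor_iff (by linarith)).1 (Nat.lt_succ_iff.1 hΛn)
    rw [hrank] at h1
    linarith
  have hEball : E.ball 1 ⊆ B.ball ρ := B.ball_refineBy_subset Λ hρ0 hρ1 hτ0 hτ2
  obtain ⟨s, hs0, hs2, hs1, hEreg⟩ := E.exists_isRegular_dilate hC
  refine ⟨E.dilate s hs0, hEreg, hEcard, ?_, ?_, ?_⟩
  · rw [carrier_dilate, carrier_eq_ball]
    exact (E.ball_mono hs1).trans (hEball.trans (B.ball_mono hρ1))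
  · rw [carrier_dilate]
    -- Four times the reciprocal of the lower bound for ρ. Below, 2N + 1 ≤ 5M and n ≤ 6q give 3840 =
    -- 5 · 128 · 6.
    set M : ℝ := 128 * (C * D) ^ 2 * n with hM
    have hMn : 128 * n ≤ M := by
      calc (128 * n : ℝ) = 128 * 1 * n := by ring
        _ ≤ 128 * (C * D) ^ 2 * n := by gcongr
    have hM1 : 1 ≤ M := by linarith
    set N : ℕ := ⌈M⌉₊ with hN
    have hMN : M ≤ N := Nat.le_ceil M
    have hNM : (N : ℝ) ≤ M + 1 := (Nat.ceil_lt_add_one (by linarith)).le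
    have hMρ : 4 ≤ M * ρ := by
      have h1 : M * (1 / (32 * (C * D) ^ 2 * n)) = 4 := by
        have : (C * D) ^ 2 ≠ 0 := by positivity
        have : (n : ℝ) ≠ 0 := by positivity
        rw [hM]; field_simp; norm_num
      rw [← h1]
      gcongr
    have h1 := B.card_carrier_le_pow_mul_card_refineBy Λ hρ0 hρ1 hτ0 hτ2 (N := N)
      (hMρ.trans (mul_le_mul_of_nonneg_right hMN hρ0.le)) (by
        rw [hτ, mul_one_div, le_div_iff₀ (by positivity)]
        linarith)
    set R : ℝ := 3840 * C ^ 2 * (K + 1) ^ 2 * k ^ 2 * q with hR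
    have hRN : 2 * (N : ℝ) + 1 ≤ R := by
      have h1 : 2 * (N : ℝ) + 1 ≤ 5 * M := by linarith
      have h2 : 5 * M ≤ R := by
        have : R = 640 * (C * D) ^ 2 * (6 * q) := by rw [hR, hD]; ring
        rw [this, hM]
        calc 5 * (128 * (C * D) ^ 2 * n) = 640 * (C * D) ^ 2 * n := by ring
          _ ≤ _ := by gcongr
      exact h1.trans h2
    have hR1 : 1 ≤ R := le_trans (by linarith [Nat.cast_nonneg (α := ℝ) N]) hRN
    refine h1.trans (mul_le_mul ?_ (E.card_ball_mono hs2) (Nat.cast_nonneg _) (by positivity))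
    calc (((2 * N + 1) ^ 2) ^ E.rank : ℝ) ≤ (R ^ 2) ^ E.rank := by gcongr
      _ = R ^ ((2 * E.rank : ℕ) : ℝ) := by rw [Real.rpow_natCast, pow_mul]
      _ ≤ R ^ (2 * (k + 4 * q)) := by
        refine Real.rpow_le_rpow_of_exponent_le hR1 ?_
        push_cast
        linarith
  · intro γ hγ x hx
    rw [carrier_dilate] at hx
    have hx1 := E.ball_mono hs1 hx
    obtain ⟨m, hm, hsmall⟩ := hΛ γ hγ
    set σ := ∑ χ ∈ Λ, m χ • χ with hσ
    have h1 : ‖1 - (γ + σ) x‖ ≤ 1 / 4 := hsmall x (hEball hx1)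
    have h2 : ‖1 - σ x‖ ≤ 1 / 4 := by
      refine (norm_one_sub_sum_zsmul_le Λ hm x).trans ?_
      refine (Finset.sum_le_card_nsmul _ _ _ 
        (fun χ hχ => B.norm_one_sub_le_of_mem_ball_refineBy Λ hρ0 hρ1 hτ0 hτ2 hρτ hx1 hχ)).trans ?_
      rw [nsmul_eq_mul, mul_one_div, div_le_div_iff₀ (by positivity) (by norm_num)]
      have : (Λ.card : ℝ) ≤ n := by exact_mod_cast hΛn.le
      linarith
    have h3 : 1 - γ x = (1 - (γ + σ) x) - γ x * (1 - σ x) := by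
      rw [AddChar.add_apply]; ring
    rw [h3]
    refine (norm_sub_le _ _).trans ?_
    rw [norm_mul, AddChar.norm_apply, one_mul]
    linarith

end BohrSet

end Chang

/-! ### The Katz–Koester transform and the density increment -/

section KatzKoester

variable {G : Type*} [AddCommGroup G] [Fintype G]

lemma norm_charSum_unifMass_ge {E : Finset G} (hE : 0 < (E.card : ℝ)) {γ : AddChar G ℂ}
    (h : ∀ x ∈ E, ‖1 - γ x‖ ≤ 1 / 2) : 1 / 2 ≤ ‖charSum (unifMass E) γ‖ := by
  have h1 : 1 - charSum (unifMass E) γ = ∑ x, (unifMass E x : ℂ) * (1 - γ x) := by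
    simp only [mul_sub, mul_one, Finset.sum_sub_distrib, charSum]
    rw [← Complex.ofReal_sum, sum_unifMass hE, Complex.ofReal_one]
  have h2 : ‖1 - charSum (unifMass E) γ‖ ≤ 1 / 2 := by
    rw [h1]
    refine (norm_sum_le _ _).trans ?_
    calc ∑ x, ‖(unifMass E x : ℂ) * (1 - γ x)‖ ≤ ∑ x, 1 / 2 * unifMass E x := by
          refine Finset.sum_le_sum fun x _ => ?_
          rw [norm_mul, Complex.norm_real, Real.norm_of_nonneg (unifMass_nonneg _ _), mul_comm]
          by_cases hx : x ∈ E
          · exact mul_le_mul_of_nonneg_right (h x hx) (unifMass_nonneg _ _)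
          · rw [unifMass_apply_of_notMem hx]; simp
      _ = 1 / 2 := by rw [← Finset.mul_sum, sum_unifMass hE, mul_one]
  have h3 := norm_sub_norm_le (1 : ℂ) (1 - charSum (unifMass E) γ)
  rw [sub_sub_cancel, norm_one] at h3
  linarith

/-- If `1_A ∗ μ_X` has large energy, then `A` has increased density on translates of any set that
is nearly annihilated by the large frequencies of `X`. -/
lemma two_mul_le_norm_convMeas {A X E : Finset G} {ε α : ℝ} (hε : ε ^ 2 = α) (hε0 : 0 ≤ ε)
    (hA : 0 < (A.card : ℝ)) (hX : 0 < (X.card : ℝ)) (hE : 0 < (E.card : ℝ))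
    (hspec : ∀ γ, ε ≤ ‖charSum (unifMass X) γ‖ → ∀ x ∈ E, ‖1 - γ x‖ ≤ 1 / 2)
    (henergy : 9 * (α * A.card) ≤ ∑ x, convMeas (indFun A) (unifMass X) x ^ 2) :
    2 * α ≤ ‖convMeas (indFun A) (unifMass E)‖ := by
  set f := convMeas (indFun A) (unifMass X)
  set g := convMeas (indFun A) (unifMass E) with hg
  have hG : 0 < (Fintype.card G : ℝ) := by exact_mod_cast Fintype.card_pos
  -- Small frequencies are absorbed by α = ε², large ones by |μ̂_E| ≥ 1/2. After Parseval the energy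
  -- 9α|A| leaves 8α|A| ≤ 4 Σ g².
  have hpt : ∀ γ, ‖charSum (unifMass X) γ‖ ^ 2 ≤ α + 4 * ‖charSum (unifMass E) γ‖ ^ 2 := by
    intro γ
    have h1 := (norm_charSum_le (unifMass_nonneg X) γ).trans (sum_unifMass hX).le
    have h0 := norm_nonneg (charSum (unifMass X) γ)
    by_cases h : ε ≤ ‖charSum (unifMass X) γ‖
    · have := norm_charSum_unifMass_ge hE (hspec γ h)
      nlinarith [sq_nonneg ε]
    · rw [not_le] at h
      nlinarith [sq_nonneg ‖charSum (unifMass E) γ‖]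
  have hAsq : ∑ x, indFun A x ^ 2 = A.card := by
    have := sum_mul_indFun A (indFun A)
    simp only [← pow_two] at this
    rw [this, Finset.sum_congr rfl fun x hx => indFun_apply_of_mem hx]
    simp
  have hsum : (Fintype.card G : ℝ) * ∑ x, f x ^ 2 ≤
      α * (Fintype.card G * A.card) + 4 * (Fintype.card G * ∑ x, g x ^ 2) := by
    rw [← hAsq, ← sum_norm_sq_charSum, ← sum_norm_sq_charSum, ← sum_norm_sq_charSum,
      Finset.mul_sum, Finset.mul_sum, ← Finset.sum_add_distrib]
    refine Finset.sum_le_sum fun γ _ => ?_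
    rw [charSum_convMeas, charSum_convMeas, norm_mul, norm_mul, mul_pow, mul_pow]
    have := mul_le_mul_of_nonneg_left (hpt γ) (sq_nonneg ‖charSum (indFun A) γ‖)
    linarith
  have hsum' : ∑ x, f x ^ 2 ≤ α * A.card + 4 * ∑ x, g x ^ 2 := by
    refine le_of_mul_le_mul_left (hsum.trans (le_of_eq ?_)) hG
    ring
  have hg0 : ∀ x, 0 ≤ g x := convMeas_nonneg (indFun_nonneg _) (unifMass_nonneg _)
  have hgsum : ∑ x, g x = A.card := by
    rw [hg, sum_convMeas, sum_indFun, sum_unifMass hE, mul_one]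
  have hsup : ∑ x, g x ^ 2 ≤ ‖g‖ * A.card := by
    rw [← hgsum, Finset.mul_sum]
    refine Finset.sum_le_sum fun x _ => ?_
    rw [pow_two]
    refine mul_le_mul_of_nonneg_right ?_ (hg0 x)
    exact (le_abs_self _).trans (norm_le_pi_norm g x)
  refine le_of_mul_le_mul_right ?_ hA
  linarith

open Classical in
lemma convMeas_indFun_unifMass (A X : Finset G) (w : G) :
    convMeas (indFun A) (unifMass X) w =
      (X.card : ℝ)⁻¹ * (X.filter fun a => w - a ∈ A).card := by
  simp only [convMeas]
  rw [sum_mul_unifMass]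
  congr 1
  simp [indFun, Set.indicator_apply]

-- For fixed y and w the tuples form a difference of two m-th powers of sets. With a = y + x i one
-- has w - x i = w + y - a, so the proportion avoiding A is one minus the convolution at w + y. As Z
-- contains X - y, restricting to Z loses nothing.
open Classical in
lemma card_pi_filter_mem_and_exists (A X Z : Finset G) (hX : 0 < (X.card : ℝ)) (m : ℕ) (y w : G)
    (hZ : ∀ a ∈ X, a - y ∈ Z) :
    (((Fintype.piFinset fun _ : Fin m => Z).filter fun x =>
      (∀ i, y + x i ∈ X) ∧ ∃ i, w - x i ∈ A).card : ℝ) =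
      (X.card : ℝ) ^ m * (1 - (1 - convMeas (indFun A) (unifMass X) (w + y)) ^ m) := by
  set P : Finset G := Finset.univ.filter fun x => y + x ∈ X
  set Q : Finset G := Finset.univ.filter fun x => y + x ∈ X ∧ w - x ∉ A
  have hP : P.card = X.card := by
    refine Finset.card_bij (fun x _ => y + x) (fun x hx => (Finset.mem_filter.1 hx).2)
      (fun a _ b _ h => add_left_cancel h) (fun a ha => ⟨a - y, ?_, by abel⟩)
    simpa [P] using ha
  have hQ : (Q.card : ℝ) = X.card * (1 - convMeas (indFun A) (unifMass X) (w + y)) := by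
    have h1 : Q.card = (X.filter fun a => ¬ (w + y - a ∈ A)).card := by
      refine Finset.card_bij (fun x _ => y + x) (fun x hx => ?_)
        (fun a _ b _ h => add_left_cancel h) (fun a ha => ⟨a - y, ?_, by abel⟩)
      · have := (Finset.mem_filter.1 hx).2
        rw [Finset.mem_filter, show w + y - (y + x) = w - x by abel]
        exact this
      · have := Finset.mem_filter.1 ha
        simp only [Q, Finset.mem_filter, Finset.mem_univ, true_and]
        rw [show y + (a - y) = a by abel, show w - (a - y) = w + y - a by abel]
        exact this
    have h2 : ((X.filter fun a => w + y - a ∈ A).card : ℝ) +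
        (X.filter fun a => ¬ (w + y - a ∈ A)).card = X.card := by
      exact_mod_cast Finset.card_filter_add_card_filter_not _
    rw [h1, convMeas_indFun_unifMass, mul_sub, mul_one, mul_inv_cancel_left₀ hX.ne']
    linarith
  have hset : ((Fintype.piFinset fun _ : Fin m => Z).filter fun x =>
      (∀ i, y + x i ∈ X) ∧ ∃ i, w - x i ∈ A) =
      (Fintype.piFinset fun _ : Fin m => P) \ (Fintype.piFinset fun _ : Fin m => Q) := by
    ext x
    simp only [Finset.mem_filter, Finset.mem_sdiff, Fintype.mem_piFinset, P, Q, Finset.mem_univ,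
      true_and]
    constructor
    · rintro ⟨-, h1, i, hi⟩
      exact ⟨h1, fun h => (h i).2 hi⟩
    · rintro ⟨h1, h2⟩
      refine ⟨fun i => ?_, h1, ?_⟩
      · have := hZ _ (h1 i)
        rwa [add_sub_cancel_left] at this
      · by_contra! hcon
        exact h2 fun i => ⟨h1 i, hcon i⟩
  have hsub : (Fintype.piFinset fun _ : Fin m => Q) ⊆ Fintype.piFinset fun _ : Fin m => P :=
    Fintype.piFinset_subset _ _ fun _ x hx => by
      have := (Finset.mem_filter.1 hx).2
      simpa [P] using this.1
  rw [hset, Finset.cast_card_sdiff hsub, Fintype.card_piFinset_const, Fintype.card_piFinset_const]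
  push_cast
  rw [hP, hQ, mul_pow]
  ring

open Classical in
/-- **Katz–Koester transform**, by averaging over the choice of the translates: some union of
translates of `A` is large while the corresponding intersection of translates of `X` is dense
in `Y`. -/
lemma exists_katz_koester (A X Y Z W : Finset G) (hX : 0 < (X.card : ℝ)) (hY : 0 < (Y.card : ℝ))
    (hZ : ∀ y ∈ Y, ∀ a ∈ X, a - y ∈ Z) (hZ0 : 0 < (Z.card : ℝ))
    (hW : ∀ a ∈ A, ∀ y ∈ Y, ∀ b ∈ X, a + (b - y) ∈ W) (m : ℕ) {c b : ℝ} (hc : 0 < c) (hb : 0 < b)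
    (hWb : (W.card : ℝ) ≤ 2 * b)
    (hsum : c * b ≤ ∑ w, (1 - (1 - convMeas (indFun A) (unifMass X) w) ^ m)) :
    ∃ x : Fin m → G,
      c / 8 * ((X.card : ℝ) / Z.card) ^ m * Y.card < (Y.filter fun y => ∀ i, y + x i ∈ X).card ∧
      c / 2 * b < (Finset.univ.filter fun w => ∃ i, w - x i ∈ A).card := by
  set S : (Fin m → G) → Finset G := fun x => Y.filter fun y => ∀ i, y + x i ∈ X
  set U : (Fin m → G) → Finset G := fun x => Finset.univ.filter fun w => ∃ i, w - x i ∈ A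
  set Ω : Finset (Fin m → G) := Fintype.piFinset fun _ : Fin m => Z with hΩ
  have hSU : ∑ x ∈ Ω, ((S x).card : ℝ) * (U x).card = Y.card * (X.card : ℝ) ^ m *
      ∑ w, (1 - (1 - convMeas (indFun A) (unifMass X) w) ^ m) := by
    have h1 : ∀ x, ((S x).card : ℝ) * (U x).card = ∑ y ∈ Y, ∑ w,
        if (∀ i, y + x i ∈ X) ∧ ∃ i, w - x i ∈ A then (1 : ℝ) else 0 := by
      intro x
      simp only [S, U, Finset.card_filter, Nat.cast_sum, Finset.sum_mul_sum]
      refine Finset.sum_congr rfl fun y _ => Finset.sum_congr rfl fun w _ => ?_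
      rw [ite_and]
      split_ifs <;> simp
    simp only [h1]
    rw [Finset.sum_comm, mul_assoc, ← nsmul_eq_mul, ← Finset.sum_const]
    refine Finset.sum_congr rfl fun y hy => ?_
    rw [Finset.sum_comm, Finset.mul_sum]
    conv_rhs => rw [← Equiv.sum_comp (Equiv.addRight y)]
    refine Finset.sum_congr rfl fun w _ => ?_
    rw [← Finset.natCast_card_filter, Equiv.coe_addRight]
    exact card_pi_filter_mem_and_exists A X Z hX m y w (hZ y hy)
  have hS : ∑ x ∈ Ω, ((S x).card : ℝ) = Y.card * (X.card : ℝ) ^ m := by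
    have h1 : ∀ x, ((S x).card : ℝ) = ∑ y ∈ Y, if ∀ i, y + x i ∈ X then (1 : ℝ) else 0 := by
      intro x
      simp only [S, Finset.card_filter, Nat.cast_sum, Nat.cast_ite, Nat.cast_one, Nat.cast_zero]
    simp only [h1]
    rw [Finset.sum_comm, ← nsmul_eq_mul, ← Finset.sum_const]
    refine Finset.sum_congr rfl fun y hy => ?_
    rw [← Finset.natCast_card_filter, ← Nat.cast_pow, ← Fintype.card_piFinset_const]
    congr 1
    refine Finset.card_bij (fun x _ i => y + x i) (fun x hx => ?_)
      (fun a _ b _ h => funext fun i => add_left_cancel (congrFun h i))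
      (fun x hx => ⟨fun i => x i - y, ?_, funext fun i => add_sub_cancel _ _⟩)
    · exact Fintype.mem_piFinset.2 (Finset.mem_filter.1 hx).2
    · rw [Fintype.mem_piFinset] at hx
      rw [Finset.mem_filter, hΩ, Fintype.mem_piFinset]
      exact ⟨fun i => hZ y hy _ (hx i), fun i => by rw [add_sub_cancel]; exact hx i⟩
  have hUW : ∀ x, ((S x).card : ℝ) * (U x).card ≤ (S x).card * (2 * b) := by
    intro x
    rcases (S x).eq_empty_or_nonempty with h | ⟨y, hy⟩
    · rw [h]; simp
    · refine mul_le_mul_of_nonneg_left (le_trans ?_ hWb) (Nat.cast_nonneg _)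
      have hy' := Finset.mem_filter.1 hy
      exact_mod_cast Finset.card_le_card fun w hw => by
        obtain ⟨i, hi⟩ := (Finset.mem_filter.1 hw).2
        have := hW _ hi y hy'.1 _ (hy'.2 i)
        rwa [add_sub_cancel_left, sub_add_cancel] at this
  by_contra! hcon
  -- If no tuple works, those with small S contribute at most a quarter of the lower bound for the
  -- sum of |S||U|, and those with small U at most a half.
  set θ := c / 8 * ((X.card : ℝ) / Z.card) ^ m * Y.card with hθ
  have hθ0 : 0 < θ := by positivity
  have hle : ∀ x ∈ Ω, ((S x).card : ℝ) * (U x).card ≤ θ * (2 * b) + (S x).card * (c / 2 * b) := by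
    intro x _
    by_cases h : θ < (S x).card
    · have h1 := mul_le_mul_of_nonneg_left (hcon x h) (Nat.cast_nonneg (α := ℝ) (S x).card)
      have : 0 < θ * (2 * b) := by positivity
      linarith
    · have h1 := mul_le_mul_of_nonneg_right (not_lt.1 h) (show 0 ≤ 2 * b by positivity)
      have h2 : 0 ≤ ((S x).card : ℝ) * (c / 2 * b) := by positivity
      linarith [hUW x]
  have h1 := Finset.sum_le_sum hle
  rw [hSU, Finset.sum_add_distrib, Finset.sum_const, nsmul_eq_mul, ← Finset.sum_mul, hS, hΩ,
    Fintype.card_piFinset_const] at h1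
  have h2 : ((Z.card ^ m : ℕ) : ℝ) * (θ * (2 * b)) = Y.card * (X.card : ℝ) ^ m * (c / 4 * b) := by
    rw [hθ, div_pow]; push_cast; field_simp; norm_num
  rw [h2] at h1
  have h3 := mul_le_mul_of_nonneg_left hsum (show 0 ≤ Y.card * (X.card : ℝ) ^ m by positivity)
  have h4 : 0 < Y.card * (X.card : ℝ) ^ m * (c * b) := by positivity
  linarith

/-- Convolutions of unions of translates of `A` with intersections of translates of `X` are
dominated by the convolution of `A` with `X`. -/
lemma convMeas_indFun_le_of_translates {A X Y L S Z : Finset G} {m : ℕ} (x : Fin m → G)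
    (hXZ : X ⊆ Z) (hZ : 0 < (Z.card : ℝ)) (hL : ∀ w ∈ L, ∃ i, w - x i ∈ A)
    (hS : ∀ y ∈ S, ∀ i, y + x i ∈ X) (w : G) :
    convMeas (indFun L) (fun y => indFun S y * unifMass Y y) w ≤
      m * ((Y.card : ℝ)⁻¹ * Z.card) *
        convMeas (indFun A) (fun y => indFun X y * unifMass Z y) w := by
  have hR : convMeas (indFun A) (fun y => indFun X y * unifMass Z y) w =
      (Z.card : ℝ)⁻¹ * ∑ y, indFun A (w - y) * indFun X y := by
    simp only [convMeas, Finset.mul_sum]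
    refine Finset.sum_congr rfl fun y _ => ?_
    by_cases hy : y ∈ X
    · rw [unifMass_apply_of_mem (hXZ hy)]; ring
    · rw [indFun_apply_of_notMem hy]; ring
  have hshift : ∀ i, ∑ y, indFun A (w - y - x i) * indFun X (y + x i) =
      ∑ y, indFun A (w - y) * indFun X y := by
    intro i
    conv_rhs => rw [← Equiv.sum_comp (Equiv.addRight (x i))]
    simp only [Equiv.coe_addRight, sub_add_eq_sub_sub]
  have hnn : ∀ y i, 0 ≤ indFun A (w - y - x i) * indFun X (y + x i) := fun y i =>
    mul_nonneg (indFun_nonneg _ _) (indFun_nonneg _ _)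
  have hpt : ∀ y, indFun L (w - y) * (indFun S y * unifMass Y y) ≤
      (Y.card : ℝ)⁻¹ * ∑ i, indFun A (w - y - x i) * indFun X (y + x i) := by
    intro y
    have hrhs : 0 ≤ (Y.card : ℝ)⁻¹ * ∑ i, indFun A (w - y - x i) * indFun X (y + x i) :=
      mul_nonneg (by positivity) (Finset.sum_nonneg fun i _ => hnn y i)
    by_cases h1 : w - y ∈ L
    · by_cases h2 : y ∈ S
      · obtain ⟨i, hi⟩ := hL _ h1
        have h3 : (1 : ℝ) ≤ ∑ i, indFun A (w - y - x i) * indFun X (y + x i) := by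
          refine le_trans ?_ (Finset.single_le_sum (fun j _ => hnn y j) (Finset.mem_univ i))
          rw [indFun_apply_of_mem hi, indFun_apply_of_mem (hS y h2 i), one_mul]
        have h4 : unifMass Y y ≤ (Y.card : ℝ)⁻¹ := by
          by_cases h : y ∈ Y
          · rw [unifMass_apply_of_mem h]
          · rw [unifMass_apply_of_notMem h]; positivity
        rw [indFun_apply_of_mem h1, indFun_apply_of_mem h2, one_mul, one_mul]
        exact h4.trans (le_mul_of_one_le_right (by positivity) h3)
      · rw [indFun_apply_of_notMem h2, zero_mul, mul_zero]; exact hrhs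
    · rw [indFun_apply_of_notMem h1, zero_mul]; exact hrhs
  refine (Finset.sum_le_sum fun y _ => hpt y).trans (le_of_eq ?_)
  rw [← Finset.mul_sum, Finset.sum_comm, Finset.sum_congr rfl fun i _ => hshift i, hR,
    Finset.sum_const, Finset.card_univ, Fintype.card_fin, nsmul_eq_mul]
  field_simp

/-- Since (1 - u)(1 + u) ≤ 1, Bernoulli gives (1 - u)^m ≤ 1/(1 + mu) ≤ 1/(1 + s) with s the minimum,
and 1 - 1/(1 + s) ≥ s/2 for s ≤ 1. -/
lemma half_min_le_one_sub_pow {u a : ℝ} (hu0 : 0 ≤ u) (hu1 : u ≤ 1) (ha : 0 < a) {m : ℕ}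
    (hm : a⁻¹ ≤ m) : 1 / 2 * min 1 (u / a) ≤ 1 - (1 - u) ^ m := by
  have h1 : 1 + m * u ≤ (1 + u) ^ m := one_add_mul_le_pow (by linarith) m
  have h2 : ((1 - u) * (1 + u)) ^ m ≤ 1 := pow_le_one₀ (by nlinarith) (by nlinarith)
  rw [mul_pow] at h2
  have h3 : 0 ≤ (1 - u) ^ m := pow_nonneg (by linarith) m
  have h4 : (1 - u) ^ m * (1 + m * u) ≤ 1 := (mul_le_mul_of_nonneg_left h1 h3).trans h2
  set s := min 1 (u / a) with hs
  have hs0 : 0 ≤ s := le_min zero_le_one (by positivity)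
  have hs1 : s ≤ 1 := min_le_left _ _
  have hs2 : s ≤ m * u := by
    refine (min_le_right _ _).trans ?_
    rw [div_eq_inv_mul]; gcongr
  have h5 : (1 - u) ^ m * (1 + s) ≤ 1 :=
    (mul_le_mul_of_nonneg_left (by linarith) h3).trans h4
  by_contra! hcon
  nlinarith

end KatzKoester

/-! ### Numerical inequalities behind the constants -/

lemma le_min_add_sq {t : ℝ} (ht : 0 ≤ t) : t ≤ 18 * min 1 t + t ^ 2 / 18 := by
  rcases le_total t 1 with h | h
  · rw [min_eq_right h]; nlinarith
  · rw [min_eq_left h]; nlinarith [sq_nonneg (t - 18)]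

/-- A function whose truncation at height `α` has small mass has large energy. -/
lemma le_sum_sq_of_sum_min_lt {G : Type*} [Fintype G] {f : G → ℝ} (hf : ∀ x, 0 ≤ f x) {α b : ℝ} (hα : 0 < α)
    (hsum : ∑ x, f x = α * b) (hmin : ∑ x, min 1 (f x / α) < b / 36) :
    9 * (α * (α * b)) ≤ ∑ x, f x ^ 2 := by
  have h1 := Finset.sum_le_sum fun x (_ : x ∈ Finset.univ) =>
    le_min_add_sq (div_nonneg (hf x) hα.le)
  rw [Finset.sum_add_distrib, ← Finset.mul_sum, ← Finset.sum_div, ← Finset.sum_div, hsum,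
    mul_div_cancel_left₀ _ hα.ne'] at h1
  simp only [div_pow] at h1
  rw [← Finset.sum_div] at h1
  have h2 : 9 * b ≤ (∑ x, f x ^ 2) / α ^ 2 := by linarith
  rw [le_div_iff₀ (by positivity)] at h2
  linarith

/-- The base Q = 2kq is at least 13/10, so a power of Q absorbs the constant W and Q² absorbs k²q.
The bound 13/20 is a value below log 2. -/
lemma rpow_mul_rpow_le_one {W k q : ℝ} {j : ℕ} (hk : 1 ≤ k) (hq : 13 / 20 ≤ q) (hW1 : 1 ≤ W)
    (hW : W ≤ (13 / 10) ^ j) {c : ℝ} (hc : 8 * (j + 2) ≤ c) :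
    (1 / (2 * k * q)) ^ (c * (k + q)) * (W * k ^ 2 * q) ^ (2 * (k + 4 * q)) ≤ 1 := by
  set Q := 2 * k * q with hQ
  have hQ1 : 13 / 10 ≤ Q := by rw [hQ]; nlinarith
  have hQ0 : 0 < Q := by linarith
  have hR : W * k ^ 2 * q ≤ Q ^ (j + 2) := by
    have h1 : k ^ 2 * q ≤ Q ^ 2 := by
      have h0 : 0 ≤ k ^ 2 * q := by positivity
      have : Q ^ 2 = k ^ 2 * q * (4 * q) := by rw [hQ]; ring
      rw [this]; nlinarith
    have h2 : W ≤ Q ^ j := hW.trans (by gcongr)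
    calc W * k ^ 2 * q = W * (k ^ 2 * q) := by ring
      _ ≤ Q ^ j * Q ^ 2 := by gcongr
      _ = Q ^ (j + 2) := by rw [pow_add]
  have h1 : (W * k ^ 2 * q) ^ (2 * (k + 4 * q)) ≤ Q ^ (c * (k + q)) := by
    calc (W * k ^ 2 * q) ^ (2 * (k + 4 * q)) ≤ (Q ^ (j + 2)) ^ (2 * (k + 4 * q)) := by gcongr
      _ = Q ^ ((j + 2 : ℕ) * (2 * (k + 4 * q))) := by
        rw [← Real.rpow_natCast, ← Real.rpow_mul hQ0.le]
      _ ≤ Q ^ (c * (k + q)) := by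
        refine Real.rpow_le_rpow_of_exponent_le (by linarith) ?_
        push_cast
        have : (0 : ℝ) ≤ j := Nat.cast_nonneg j
        calc ((j : ℝ) + 2) * (2 * (k + 4 * q)) ≤ (j + 2) * (8 * (k + q)) := by
              refine mul_le_mul_of_nonneg_left ?_ (by positivity)
              linarith
          _ = 8 * (j + 2) * (k + q) := by ring
          _ ≤ c * (k + q) := by gcongr
  rw [one_div, Real.inv_rpow hQ0.le]
  have h2 : 0 < Q ^ (c * (k + q)) := Real.rpow_pos_of_pos hQ0 _
  rw [← div_eq_inv_mul, div_le_one h2]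
  exact h1

/-! ### Relative densities -/

section RelDensity

variable {G : Type*}

lemma relDensity_mul_card {X A : Finset G} (hA : A ⊆ X) (hX : 0 < (X.card : ℝ)) :
    relDensity X A * X.card = A.card := by
  classical
  rw [relDensity, Finset.inter_eq_left.2 hA, div_mul_cancel₀ _ hX.ne']

lemma relDensity_le_one {X : Finset G} (hX : 0 < (X.card : ℝ)) (A : Finset G) :
    relDensity X A ≤ 1 := by
  classical
  rw [relDensity, div_le_one hX]
  exact_mod_cast Finset.card_le_card Finset.inter_subset_right

lemma le_relDensity {X A : Finset G} (hA : A ⊆ X) (hX : 0 < (X.card : ℝ)) {t : ℝ}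
    (h : t * X.card ≤ A.card) : t ≤ relDensity X A := by
  rw [← relDensity_mul_card hA hX] at h
  exact le_of_mul_le_mul_right h hX

end RelDensity

/-! ### The two alternatives -/

namespace BohrSet

variable {G : Type*} [AddCommGroup G] [Fintype G]

/-- The density increment when `1_A ∗ μ_{A'}` has large energy. -/
lemma exists_density_increment {K C : ℝ} (hK : 0 < K) (hC : 80 ≤ C) {B' : BohrSet G} {k : ℕ}
    (hk : 1 ≤ k) (hrank : B'.rank = k) {d' : ℝ} (hd0 : 0 < d') (hd : d' ≤ K * k)
    (hB' : B'.IsRegularAt C d') {A A' : Finset G} {α : ℝ} (hα : 0 < α) (hα1 : α ≤ 1)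
    (hA : 0 < (A.card : ℝ)) (hA' : A' ⊆ B'.carrier) (hA'0 : 0 < relDensity B'.carrier A')
    (henergy : 9 * (α * A.card) ≤ ∑ x, convMeas (indFun A) (unifMass A') x ^ 2) {j : ℕ}
    (hj : 3840 * C ^ 2 * (K + 1) ^ 2 ≤ (13 / 10) ^ j) {c : ℝ} (hc : 8 * (j + 2) ≤ c) :
    ∃ E : BohrSet G, E.IsRegular C ∧
      (E.rank : ℝ) ≤ k + c * (α⁻¹ * Real.log (2 * (relDensity B'.carrier A')⁻¹)) ∧
      (α / (2 * k * Real.log (2 * (relDensity B'.carrier A')⁻¹))) ^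
          (c * (k + α⁻¹ * Real.log (2 * (relDensity B'.carrier A')⁻¹)))
        ≤ relDensity B'.carrier E.carrier ∧
      2 * α ≤ ‖convMeas (indFun A) (unifMass E.carrier)‖ := by
  set α' := relDensity B'.carrier A' with hα'
  have hB'pos := B'.card_carrier_pos
  have hα'1 : α' ≤ 1 := relDensity_le_one hB'pos A'
  have hA'pos : 0 < (A'.card : ℝ) := by
    rw [← relDensity_mul_card hA' hB'pos]; positivity
  set ℓ := Real.log (2 * α'⁻¹) with hℓ
  have hℓ1 : 13 / 20 ≤ ℓ := by
    have h1 : Real.log 2 ≤ ℓ :=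
      Real.log_le_log two_pos (by linarith [(one_le_inv₀ hA'0).2 hα'1])
    linarith [Real.log_two_gt_d9]
  set q := α⁻¹ * ℓ with hq
  have hqℓ : ℓ ≤ q := le_mul_of_one_le_left (by linarith) ((one_le_inv₀ hα).2 hα1)
  have hε2 : Real.sqrt α ^ 2 = α := Real.sq_sqrt hα.le
  obtain ⟨E, hreg, hrk, hsub, hcard, hspec⟩ := exists_isRegular_of_large_charSum hK hC hk hrank
    hd0 hd hB' hA' hA'0 (Real.sqrt_pos.2 hα) (q := q) (by rw [hε2]) (by linarith)
  have hk1 : (1 : ℝ) ≤ k := by exact_mod_cast hk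
  have hj0 : (0 : ℝ) ≤ j := Nat.cast_nonneg j
  refine ⟨E, hreg, hrk.trans ?_, le_relDensity hsub hB'pos ?_, ?_⟩
  · have : 4 * q ≤ c * q := mul_le_mul_of_nonneg_right (by linarith) (by linarith)
    linarith
  · have hbase : α / (2 * k * ℓ) = 1 / (2 * k * q) := by
      have : ℓ ≠ 0 := by linarith
      rw [hq]; field_simp
    rw [hbase]
    have hW1 : 1 ≤ 3840 * C ^ 2 * (K + 1) ^ 2 := by
      have h1 : 1 ≤ C ^ 2 := one_le_pow₀ (by linarith)
      have h2 : 1 ≤ (K + 1) ^ 2 := one_le_pow₀ (by linarith)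
      nlinarith
    have hone := rpow_mul_rpow_le_one hk1 (hℓ1.trans hqℓ) hW1 hj hc
    have hq0 : 0 < q := by linarith
    calc _ ≤ (1 / (2 * k * q)) ^ (c * (k + q)) * ((3840 * C ^ 2 * (K + 1) ^ 2 * k ^ 2 * q) ^
            (2 * (k + 4 * q)) * E.carrier.card) := by gcongr
      _ = (1 / (2 * k * q)) ^ (c * (k + q)) * (3840 * C ^ 2 * (K + 1) ^ 2 * k ^ 2 * q) ^
            (2 * (k + 4 * q)) * E.carrier.card := by ring
      _ ≤ 1 * E.carrier.card := by gcongr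
      _ = E.carrier.card := one_mul _
  · exact two_mul_le_norm_convMeas hε2 (Real.sqrt_nonneg _) hA hA'pos E.card_carrier_pos hspec
      henergy

/-- The structured case: `1_A ∗ μ_{A'}` is spread out. -/
lemma exists_spread_sets {C : ℝ} {B B' B'' : BohrSet G} {A A' : Finset G} {d d' ρ ρ' : ℝ}
    (hC : 0 < C) (hd : 0 < d) (hB : B.IsRegularAt C d) (hd' : 0 < d') (hB' : B'.IsRegularAt C d')
    (hρ' : 0 < ρ') (hρ'1 : 576 * (C * d) * ρ' ≤ 1) (hρ : 0 < ρ) (hρ1 : ρ ≤ 1)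
    (hρd : C * d' * ρ ≤ 1) (hB'B : B'.carrier ⊆ B.ball ρ') (hB''B' : B''.carrier ⊆ B'.ball ρ)
    (hA : A ⊆ B.carrier) (hA' : A' ⊆ B'.carrier) {α α' : ℝ} (hα : relDensity B.carrier A = α)
    (hα0 : 0 < α) (hα' : relDensity B'.carrier A' = α') (hα'0 : 0 < α')
    (hspread : (B.carrier.card : ℝ) / 36 ≤
      ∑ w, min 1 (convMeas (indFun A) (unifMass A') w / α)) :
    ∃ L S : Finset G, L ⊆ B.carrier ∧ S ⊆ B''.carrier ∧ 1 / 288 ≤ relDensity B.carrier L ∧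
      (α' / 2) ^ (12 * α⁻¹) ≤ relDensity B''.carrier S ∧
      ∀ x : G, convMeas (indFun L) (fun y => indFun S y * unifMass B''.carrier y) x
        ≤ 12 * α⁻¹ * (relDensity B'.carrier B''.carrier)⁻¹
          * convMeas (indFun A) (fun y => indFun A' y * unifMass B'.carrier y) x := by
  classical
  have hBpos := B.card_carrier_pos
  have hB'pos := B'.card_carrier_pos
  have hB''pos := B''.card_carrier_pos
  have hα1 : α ≤ 1 := hα ▸ relDensity_le_one hBpos A
  have hα'1 : α' ≤ 1 := hα' ▸ relDensity_le_one hB'pos A'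
  have hA'card : α' * B'.carrier.card = A'.card := hα' ▸ relDensity_mul_card hA' hB'pos
  have hA'pos : 0 < (A'.card : ℝ) := by rw [← hA'card]; positivity
  have hsub : B''.carrier ⊆ B'.carrier := by
    rw [B'.carrier_eq_ball]; exact hB''B'.trans (B'.ball_mono hρ1)
  set Z := B'.ball (1 + ρ) with hZ
  have hZpos : 0 < (Z.card : ℝ) := B'.card_ball_pos (by linarith)
  have hZ2 : (Z.card : ℝ) ≤ 2 * B'.carrier.card := by
    have hCd : 0 < C * d' := by positivity
    have := ((isRegularAt_iff.1 hB').2 ρ (by linarith)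
      (by rw [abs_of_pos hρ, le_div_iff₀ hCd]; linarith)).2
    rw [abs_of_pos hρ, ← carrier_eq_ball] at this
    refine this.trans (mul_le_mul_of_nonneg_right (by linarith) (Nat.cast_nonneg _))
  set W := B.ball (1 + 2 * ρ') with hW
  -- The union U of translates will have more than |B|/144 elements inside W, so discarding W \ B
  -- leaves at least |B|/288 of them.
  have hWcard : (W.card : ℝ) ≤ (1 + 1 / 288) * B.carrier.card := by
    have hCd : 0 < C * d := by positivity
    have h2 : |2 * ρ'| = 2 * ρ' := abs_of_pos (by positivity)
    have h0 : 0 < C * d * ρ' := by positivity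
    have := ((isRegularAt_iff.1 hB).2 (2 * ρ') (by linarith)
      (by rw [h2, le_div_iff₀ hCd]; linarith)).2
    rw [h2, ← carrier_eq_ball] at this
    refine this.trans (mul_le_mul_of_nonneg_right (by linarith) (Nat.cast_nonneg _))
  have hBW : B.carrier ⊆ W := by
    rw [carrier_eq_ball]; exact B.ball_mono (by linarith)
  have hAZ : ∀ y ∈ B''.carrier, ∀ a ∈ A', a - y ∈ Z := fun y hy a ha =>
    sub_mem_ball (B'.carrier_eq_ball ▸ hA' ha) (hB''B' hy)
  have hAW : ∀ a ∈ A, ∀ y ∈ B''.carrier, ∀ b ∈ A', a + (b - y) ∈ W := by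
    intro a ha y hy b hb
    have h1 := sub_mem_ball (hB'B (hA' hb)) (hB'B (hsub hy))
    rw [← two_mul] at h1
    exact add_mem_ball (B.carrier_eq_ball ▸ hA ha) h1
  set m : ℕ := ⌈α⁻¹⌉₊ with hm
  have hαinv : 1 ≤ α⁻¹ := (one_le_inv₀ hα0).2 hα1
  have hm1 : α⁻¹ ≤ m := Nat.le_ceil _
  have hm2 : (m : ℝ) ≤ α⁻¹ + 1 := (Nat.ceil_lt_add_one (by linarith)).le
  have hf0 : ∀ w, 0 ≤ convMeas (indFun A) (unifMass A') w :=
    convMeas_nonneg (indFun_nonneg _) (unifMass_nonneg _)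
  have hf1 : ∀ w, convMeas (indFun A) (unifMass A') w ≤ 1 := by
    intro w
    rw [convMeas_indFun_unifMass, ← div_eq_inv_mul, div_le_one hA'pos]
    exact_mod_cast Finset.card_filter_le _ _
  obtain ⟨x, hS, hU⟩ := exists_katz_koester A A' B''.carrier Z W hA'pos hB''pos hAZ hZpos hAW m
    (c := 1 / 72) (by norm_num) hBpos (by linarith) (by
      have h1 := Finset.sum_le_sum fun w (_ : w ∈ Finset.univ) =>
        half_min_le_one_sub_pow (hf0 w) (hf1 w) hα0 hm1
      rw [← Finset.mul_sum] at h1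
      linarith)
  set S := B''.carrier.filter fun y => ∀ i, y + x i ∈ A' with hSdef
  set U : Finset G := Finset.univ.filter fun w => ∃ i, w - x i ∈ A with hUdef
  have hSne : S.Nonempty := by
    rw [← Finset.card_pos]
    have : (0 : ℝ) < S.card := lt_of_le_of_lt (by positivity) hS
    exact_mod_cast this
  obtain ⟨y₀, hy₀⟩ := hSne
  have hy₀' := Finset.mem_filter.1 hy₀
  have hUW : U ⊆ W := by
    intro w hw
    obtain ⟨i, hi⟩ := (Finset.mem_filter.1 hw).2
    have := hAW _ hi y₀ hy₀'.1 _ (hy₀'.2 i)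
    rwa [add_sub_cancel_left, sub_add_cancel] at this
  refine ⟨U ∩ B.carrier, S, Finset.inter_subset_right, Finset.filter_subset _ _,
    le_relDensity Finset.inter_subset_right hBpos ?_,
    le_relDensity (Finset.filter_subset _ _) hB''pos ?_, fun w => ?_⟩
  · have h1 : ((U ∩ B.carrier).card : ℝ) + (U ∪ B.carrier).card = U.card + B.carrier.card := by
      exact_mod_cast Finset.card_inter_add_card_union U B.carrier
    have h2 : ((U ∪ B.carrier).card : ℝ) ≤ W.card := by
      exact_mod_cast Finset.card_le_card (Finset.union_subset hUW hBW)
    linarith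
  · refine le_trans (mul_le_mul_of_nonneg_right ?_ hB''pos.le) hS.le
    have h1 : α' / 2 ≤ A'.card / Z.card := by
      rw [le_div_iff₀ hZpos, ← hA'card]
      calc α' / 2 * Z.card ≤ α' / 2 * (2 * B'.carrier.card) := by gcongr
        _ = α' * B'.carrier.card := by ring
    -- Ten spare factors pay for the constant 1/576, and 10 + m ≤ 12/α because m ≤ 1/α + 1.
    have h2 : (α' / 2) ^ 10 ≤ 1 / 72 / 8 := by
      calc (α' / 2) ^ 10 ≤ (1 / 2) ^ 10 := by gcongr
        _ ≤ 1 / 72 / 8 := by norm_num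
    calc (α' / 2) ^ (12 * α⁻¹) ≤ (α' / 2) ^ ((10 + m : ℕ) : ℝ) := by
          refine Real.rpow_le_rpow_of_exponent_ge (by positivity) (by linarith) ?_
          push_cast; linarith
      _ = (α' / 2) ^ 10 * (α' / 2) ^ m := by rw [Real.rpow_natCast, pow_add]
      _ ≤ 1 / 72 / 8 * (A'.card / Z.card) ^ m := by gcongr
  · refine (convMeas_indFun_le_of_translates x hA' hB'pos
      (fun w hw => (Finset.mem_filter.1 (Finset.inter_subset_left hw)).2)
      (fun y hy => (Finset.mem_filter.1 hy).2) w).trans ?_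
    refine mul_le_mul_of_nonneg_right ?_ (convMeas_nonneg (indFun_nonneg _)
      (fun y => mul_nonneg (indFun_nonneg _ _) (unifMass_nonneg _ _)) w)
    have h1 : (relDensity B'.carrier B''.carrier)⁻¹ =
        (B''.carrier.card : ℝ)⁻¹ * B'.carrier.card := by
      rw [relDensity, Finset.inter_eq_left.2 hsub, inv_div, div_eq_inv_mul]
    rw [h1]
    gcongr
    linarith

end BohrSet

/-! ### The dichotomy -/

theorem mainTheorem4 :
    ∃ C₀ : ℝ, 1 ≤ C₀ ∧ ∀ Creg : ℝ, C₀ ≤ Creg → ∀ K : ℝ, 0 < K →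
    ∃ c C : ℝ, 0 < c ∧ c ≤ 1 ∧ 1 ≤ C ∧
    ∀ (G : Type*) [AddCommGroup G] [Fintype G]
      (B B' B'' : BohrSet G) (A A' : Finset G) (d d' : ℝ) (k : ℕ) (ρ' ρ'' α α' : ℝ)
      (hρ' : 0 < ρ') (hρ'' : 0 < ρ''),
      -- `B` is a regular `d`-dimensional Bohr set
      0 < d → B.IsRegularAt Creg d →
      -- `B'` is a regular Bohr set of rank `k` (and so of dimension `O(k)`)
      1 ≤ k → B'.rank = k → 0 < d' → d' ≤ K * k → B'.IsRegularAt Creg d' →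
      B'.carrier ⊆ (B.dilate ρ' hρ').carrier →
      B''.carrier ⊆ (B'.dilate ρ'' hρ'').carrier →
      A ⊆ B.carrier → relDensity B.carrier A = α → 0 < α →
      A' ⊆ B'.carrier → relDensity B'.carrier A' = α' → 0 < α' →
      ρ' ≤ c * α / d → ρ'' ≤ c * α' / k →
      (∃ B''' : BohrSet G, B'''.IsRegular Creg ∧
        (B'''.rank : ℝ) ≤ k + C * (α⁻¹ * Real.log (2 * α'⁻¹)) ∧
        (α / (2 * k * Real.log (2 * α'⁻¹))) ^ (C * (k + α⁻¹ * Real.log (2 * α'⁻¹)))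
          ≤ relDensity B'.carrier B'''.carrier ∧
        -- the norm is the supremum norm on `G → ℝ`
        α * (1 + c) ≤ ‖convMeas (indFun A) (unifMass B'''.carrier)‖) ∨
      (∃ L S : Finset G, L ⊆ B.carrier ∧ S ⊆ B''.carrier ∧
        c ≤ relDensity B.carrier L ∧
        (α' / 2) ^ (C * α⁻¹) ≤ relDensity B''.carrier S ∧
        ∀ x : G,
          convMeas (indFun L) (fun y => indFun S y * unifMass B''.carrier y) x
            ≤ C * α⁻¹ * (relDensity B'.carrier B''.carrier)⁻¹
              * convMeas (indFun A) (fun y => indFun A' y * unifMass B'.carrier y) x) := by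
  refine ⟨80, by norm_num, fun Creg hCreg K hK => ?_⟩
  -- This j lets the covering constant be absorbed into the exponent C = 8(j + 2), which also
  -- exceeds the 12 of the spread case.
  obtain ⟨j, hj⟩ := pow_unbounded_of_one_lt (3840 * Creg ^ 2 * (K + 1) ^ 2)
    (show (1 : ℝ) < 13 / 10 by norm_num)
  have hj0 : (0 : ℝ) ≤ j := Nat.cast_nonneg j
  have hCK : 80 ≤ Creg * (K + 1) := by nlinarith
  refine ⟨1 / (576 * (Creg * (K + 1))), 8 * (j + 2), by positivity, ?_, by linarith, ?_⟩
  · rw [div_le_one (by positivity)]; linarith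
  set c := 1 / (576 * (Creg * (K + 1))) with hc
  have hc0 : 0 < c := by positivity
  have hcC : 576 * (Creg * (K + 1)) * c = 1 := by
    rw [hc, mul_one_div_cancel (by positivity)]
  have hc1 : c ≤ 1 / 288 := by
    rw [hc]; exact one_div_le_one_div_of_le (by norm_num) (by linarith)
  intro G _ _ B B' B'' A A' d d' k ρ' ρ'' α α' hρ' hρ'' hd hB hk hrank hd' hd'K hB' hB'B hB''B'
    hA hα hα0 hA' hα' hα'0 hρ'c hρ''c
  rw [BohrSet.carrier_dilate] at hB'B hB''B'
  have hk1 : (1 : ℝ) ≤ k := by exact_mod_cast hk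
  have hBpos := B.card_carrier_pos
  have hα1 : α ≤ 1 := hα ▸ relDensity_le_one hBpos A
  have hα'1 : α' ≤ 1 := hα' ▸ relDensity_le_one B'.card_carrier_pos A'
  have hAcard : α * B.carrier.card = A.card := hα ▸ relDensity_mul_card hA hBpos
  have hApos : 0 < (A.card : ℝ) := by rw [← hAcard]; positivity
  by_cases hspread : (B.carrier.card : ℝ) / 36 ≤
      ∑ w, min 1 (convMeas (indFun A) (unifMass A') w / α)
  · right
    rw [le_div_iff₀ hd] at hρ'c
    rw [le_div_iff₀ (by linarith)] at hρ''c
    have hcα : c * α ≤ c := mul_le_of_le_one_right hc0.le hα1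
    have hcα' : c * α' ≤ c := mul_le_of_le_one_right hc0.le hα'1
    have hρ''k : ρ'' ≤ ρ'' * k := le_mul_of_one_le_right hρ''.le hk1
    have hCregc : 576 * Creg * c ≤ 1 := by
      rw [← hcC]
      have : Creg ≤ Creg * (K + 1) := le_mul_of_one_le_right (by linarith) (by linarith)
      nlinarith
    obtain ⟨L, S, hL, hS, hLc, hSc, hconv⟩ := BohrSet.exists_spread_sets (by linarith) hd hB hd'
      hB' hρ' (by
        calc 576 * (Creg * d) * ρ' = 576 * Creg * (ρ' * d) := by ring
          _ ≤ 576 * Creg * c := by gcongr; linarith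
          _ ≤ 1 := hCregc) hρ'' (by linarith) (by
        calc Creg * d' * ρ'' ≤ Creg * (K * k) * ρ'' := by gcongr
          _ = Creg * K * (ρ'' * k) := by ring
          _ ≤ Creg * (K + 1) * c := by gcongr <;> linarith
          _ ≤ 1 := by nlinarith) hB'B hB''B' hA hA' hα hα0 hα' hα'0 hspread
    have hαinv : 0 < α⁻¹ := inv_pos.2 hα0
    refine ⟨L, S, hL, hS, hc1.trans hLc, le_trans ?_ hSc, fun x => (hconv x).trans ?_⟩
    · refine Real.rpow_le_rpow_of_exponent_ge (by positivity) (by linarith) ?_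
      gcongr; linarith
    · refine mul_le_mul_of_nonneg_right ?_ (convMeas_nonneg (indFun_nonneg _)
        (fun y => mul_nonneg (indFun_nonneg _ _) (unifMass_nonneg _ _)) x)
      have : 0 ≤ (relDensity B'.carrier B''.carrier)⁻¹ := by unfold relDensity; positivity
      gcongr; linarith
  · left
    have hA'pos : 0 < (A'.card : ℝ) := by
      rw [← relDensity_mul_card hA' B'.card_carrier_pos, hα']
      exact mul_pos hα'0 B'.card_carrier_pos
    have henergy := le_sum_sq_of_sum_min_lt (f := convMeas (indFun A) (unifMass A'))
      (convMeas_nonneg (indFun_nonneg _) (unifMass_nonneg _)) hα0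
      (by rw [sum_convMeas, sum_indFun, sum_unifMass hA'pos, mul_one, hAcard])
      (not_le.1 hspread)
    rw [hAcard] at henergy
    subst hα'
    obtain ⟨E, h1, h2, h3, h4⟩ := BohrSet.exists_density_increment hK hCreg hk hrank hd' hd'K hB'
      hα0 hα1 hApos hA' hα'0 henergy hj.le le_rfl
    refine ⟨E, h1, h2, h3, le_trans ?_ h4⟩
    nlinarith
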